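/- **Setting.** An *O-category* is a category whose hom-sets are dcpos and whose composition is continuous; a functor is *locally continuous* if its action on each hom-set is continuous. An *embedding* is a morphism $e$ for which there is a (unique) $e^p$ with $e^p\circ e=\mathrm{id}$ and $e\circ e^p\sqsubseteq\mathrm{id}$. An *O-colimit* of an $\omega$-chain of embeddings is a cocone of embeddings $\kappa_n$ such that $(\kappa_n\circ\kappa_n^p)_n$ is ascending with supremum $\mathrm{id}$. An O-category *supports canonical fixed points* if it has an initial object $\bot$, has zero morphisms which are the least elements of the hom-sets, and every $\omega$-chain of embeddings has an O-colimit. Let $\mathbf M$ be the O-category of Scott domains (bounded-complete algebraic dcpos with least element and countably many compact elements) and strict continuous functions preserving binary meets, ordered pointwise. Fix an initial object of $\mathbf M$ and an O-colimit for each $\omega$-chain of embeddings. For a locally continuous $F:\mathbf D\times\mathbf M\to\mathbf M$, the functor $F^\dagger:\mathbf D\to\mathbf M$ sends an object $D$ to the vertex of the chosen O-colimit $\phi^{F,D}$ of $\bot\to F_D\bot\to F_D^2\bot\to\cdots$, where $F_D=F(D,-)$. For a natural transformation $\eta:F\Rightarrow G$ put $(\eta^\dagger)_D=\bigsqcup_n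 \phi^{G,D}_n\circ\eta_D^{(n)}\circ(\phi^{F,D}_n)^p$, where $\eta_D=\eta_{(D,-)}:F_D\Rightarrow G_D$ and $\eta_D^{(n)}:F_D^n\bot\to G_D^n\bot$ is the component at $\bot$ of the $n$-fold horizontal iterate; likewise $F^\dagger f$ for $f:D\to D'$ is given by the same formula applied to $F(f,-):F_D\Rightarrow F_{D'}$. Session types over a list $\Xi=\alpha_1,\dots,\alpha_n$ of type variables are generated by: $\Xi\vdash\alpha_i$; and if $\Xi,\alpha\vdash A$ then $\Xi\vdash\rho\alpha.A$ (types are identified up to renaming of bound variables). A type $\Xi\vdash A$ denotes locally continuous functors $⟦A⟧,⟦A⟧^-,⟦A⟧^+:\mathbf M^n\to\mathbf M$ and a natural transformation $⦅A⦆:⟦A⟧\Rightarrow⟦A⟧^-\times⟦A⟧^+$, with components $⦅A⦆^-=\pi_1\circ⦅A⦆$ and $⦅A⦆^+=\pi_2\circ⦅A⦆$. For a variable, the three functors are the projection $\pi_i$ and $⦅\alpha_i⦆=\langle\mathrm{id},\mathrm{id}\rangle$. For $\rho\alpha.A$, regarding $\mathbf M^{n+1}$ as $\mathbf M^n\times\mathbf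 M$, the three functors are $⟦A⟧^\dagger$, $(⟦A⟧^-)^\dagger$, $(⟦A⟧^+)^\dagger$, and $⦅\rho\alpha.A⦆=\langle(⦅A⦆^-)^\dagger,(⦅A⦆^+)^\dagger\rangle$. **Proposition.** $\mathbf M$ supports canonical fixed points, and for every choice of initial object and O-colimits as above: 1. for every $\Xi\vdash A$, each component of $⦅A⦆$ is an embedding in $\mathbf M$; 2. if $\alpha_1,\dots,\alpha_n\vdash A$ and $\Theta\vdash B_i$ for $1\le i\le n$, then, as equalities of functors, $$⟦[\vec B/\vec\alpha]A⟧=⟦A⟧\circ\langle⟦B_i⟧\rangle_{i},\quad ⟦[\vec B/\vec\alpha]A⟧^-=⟦A⟧^-\circ\langle⟦B_i⟧^-\rangle_{i},\quad ⟦[\vec B/\vec\alpha]A⟧^+=⟦A⟧^+\circ\langle⟦B_i⟧^+\rangle_{i};$$ 3. in the situation of 2, the 2-cells compose horizontally, polarity by polarity: $$⦅[\vec B/\vec\alpha]A⦆=\big\langle\,⦅A⦆^-\ast\langle⦅B_i⦆^-\rangle_i,\ ⦅A⦆^+\ast\langle⦅B_i⦆^+\rangle_i\,\big\rangle ,$$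 where $\ast$ is horizontal composition of natural transformations. -/

import Mathlib

open CategoryTheory

universe v v₁ v₂ v₃ u u₁ u₂ u₃

namespace SessionSem

/-! ## Categories whose hom-sets are dcpos -/

/-- An O-category: every hom-set is a dcpo, and composition is (jointly) Scott continuous. -/
class OCategory (K : Type u) [Category.{v} K] where
  homOrder : ∀ X Y : K, PartialOrder (X ⟶ Y)
  exists_isLUB : ∀ {X Y : K} (s : Set (X ⟶ Y)), s.Nonempty → DirectedOn (· ≤ ·) s →
    ∃ f, IsLUB s f
  comp_continuous : ∀ X Y Z : K,
    ScottContinuous (fun p : (X ⟶ Y) × (Y ⟶ Z) => p.1 ≫ p.2)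

attribute [reducible, instance] OCategory.homOrder

section OCategories

variable {K : Type u} [Category.{v} K] [OCategory K]

theorem scottContinuous_comp {α : Type*} [Preorder α] {X Y Z : K} {f : α → (X ⟶ Y)}
    {g : α → (Y ⟶ Z)} (hf : ScottContinuous f) (hg : ScottContinuous g) :
    ScottContinuous fun a => f a ≫ g a :=
  ScottContinuous.comp (hf.prodMk hg) (OCategory.comp_continuous X Y Z)

theorem comp_mono {X Y Z : K} {f f' : X ⟶ Y} {g g' : Y ⟶ Z} (hf : f ≤ f') (hg : g ≤ g') :
    f ≫ g ≤ f' ≫ g' :=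
  (OCategory.comp_continuous X Y Z).monotone (show (f, g) ≤ (f', g') from ⟨hf, hg⟩)

/-- `(e, p)` is an embedding-projection pair. -/
structure IsEPPair {X Y : K} (e : X ⟶ Y) (p : Y ⟶ X) : Prop where
  comp_eq : e ≫ p = 𝟙 X
  comp_le : p ≫ e ≤ 𝟙 Y

/-- `e` is an embedding. -/
def IsEmbedding {X Y : K} (e : X ⟶ Y) : Prop := ∃ p : Y ⟶ X, IsEPPair e p

/-- The projection `e^p` associated with an embedding `e`. -/
noncomputable def IsEmbedding.proj {X Y : K} {e : X ⟶ Y} (h : IsEmbedding e) : Y ⟶ X :=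
  Classical.choose h

theorem IsEmbedding.isEPPair {X Y : K} {e : X ⟶ Y} (h : IsEmbedding e) : IsEPPair e h.proj :=
  Classical.choose_spec h

theorem IsEPPair.unique {X Y : K} {e : X ⟶ Y} {p q : Y ⟶ X} (hp : IsEPPair e p)
    (hq : IsEPPair e q) : p = q := by
  apply le_antisymm
  · calc p = p ≫ e ≫ q := by rw [hq.comp_eq, Category.comp_id]
      _ = (p ≫ e) ≫ q := (Category.assoc _ _ _).symm
      _ ≤ 𝟙 Y ≫ q := comp_mono hp.comp_le le_rfl
      _ = q := Category.id_comp q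
  · calc q = q ≫ e ≫ p := by rw [hp.comp_eq, Category.comp_id]
      _ = (q ≫ e) ≫ p := (Category.assoc _ _ _).symm
      _ ≤ 𝟙 Y ≫ p := comp_mono hq.comp_le le_rfl
      _ = p := Category.id_comp p

theorem IsEPPair.id (X : K) : IsEPPair (𝟙 X) (𝟙 X) :=
  ⟨Category.id_comp _, (Category.id_comp _).le⟩

theorem IsEPPair.comp {X Y Z : K} {e : X ⟶ Y} {p : Y ⟶ X} {e' : Y ⟶ Z} {p' : Z ⟶ Y}
    (h : IsEPPair e p) (h' : IsEPPair e' p') : IsEPPair (e ≫ e') (p' ≫ p) := by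
  constructor
  · calc (e ≫ e') ≫ p' ≫ p = e ≫ (e' ≫ p') ≫ p := by simp only [Category.assoc]
      _ = 𝟙 X := by rw [h'.comp_eq, Category.id_comp, h.comp_eq]
  · calc (p' ≫ p) ≫ e ≫ e' = p' ≫ (p ≫ e) ≫ e' := by simp only [Category.assoc]
      _ ≤ p' ≫ 𝟙 Y ≫ e' := comp_mono le_rfl (comp_mono h.comp_le le_rfl)
      _ = p' ≫ e' := by rw [Category.id_comp]
      _ ≤ 𝟙 Z := h'.comp_le

theorem IsEmbedding.comp {X Y Z : K} {e : X ⟶ Y} {e' : Y ⟶ Z} (h : IsEmbedding e)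
    (h' : IsEmbedding e') : IsEmbedding (e ≫ e') :=
  ⟨_, h.isEPPair.comp h'.isEPPair⟩

variable (K) in
/-- An ω-chain in the subcategory of embeddings. -/
structure EmbChain where
  functor : ℕ ⥤ K
  isEmbedding : ∀ {m n : ℕ} (f : m ⟶ n), IsEmbedding (functor.map f)

/-- An O-colimit of a chain of embeddings: a cocone of embeddings `κ` such that the
`κ_n ∘ κ_n^p` form an ascending chain with supremum the identity. -/
structure OColimit (J : EmbChain K) where
  cocone : Limits.Cocone J.functor
  isEmbedding : ∀ n, IsEmbedding (cocone.ι.app n)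
  ascending : Monotone fun n => (isEmbedding n).proj ≫ cocone.ι.app n
  isLUB : IsLUB (Set.range fun n => (isEmbedding n).proj ≫ cocone.ι.app n) (𝟙 cocone.pt)

variable (K) in
/-- Strict morphisms: the zero morphisms are the least elements of the hom-sets. -/
class HasStrictMorphisms [Limits.HasZeroMorphisms K] : Prop where
  zero_le : ∀ {X Y : K} (f : X ⟶ Y), (0 : X ⟶ Y) ≤ f

variable (K) in
/-- `K` has an initial object, has strict morphisms, and is O-cocomplete. -/
structure SupportsCanonicalFixedPoints [Limits.HasZeroMorphisms K] : Prop where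
  hasInitial : Limits.HasInitial K
  strict : HasStrictMorphisms K
  ocomplete : ∀ J : EmbChain K, Nonempty (OColimit J)

variable (K) in
/-- A choice of the data from which canonical fixed points are computed: an initial object, and
an O-colimit for every chain of embeddings. -/
structure FixChoice where
  bot : K
  isInitial : Limits.IsInitial bot
  colim : ∀ J : EmbChain K, OColimit J

end OCategories

/-! ## Products of O-categories and locally continuous functors -/

instance prodOCategory {C : Type u₁} [Category.{v₁} C] [OCategory C]
    {D : Type u₂} [Category.{v₂} D] [OCategory D] : OCategory (C × D) where
  homOrder X Y := Prod.instPartialOrder (X.1 ⟶ Y.1) (X.2 ⟶ Y.2)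
  exists_isLUB {X Y} s hs hd := by
    obtain ⟨f, hf⟩ := OCategory.exists_isLUB
      ((Prod.fst : (X.1 ⟶ Y.1) × (X.2 ⟶ Y.2) → _) '' s) (hs.image _) (DirectedOn.fst hd)
    obtain ⟨g, hg⟩ := OCategory.exists_isLUB
      ((Prod.snd : (X.1 ⟶ Y.1) × (X.2 ⟶ Y.2) → _) '' s) (hs.image _) (DirectedOn.snd hd)
    exact ⟨(f, g), isLUB_prod.2 ⟨hf, hg⟩⟩
  comp_continuous X Y Z :=
    ScottContinuous.prodMk
      (α := ((X.1 ⟶ Y.1) × (X.2 ⟶ Y.2)) × ((Y.1 ⟶ Z.1) × (Y.2 ⟶ Z.2)))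
      (scottContinuous_comp (X := X.1) (Y := Y.1) (Z := Z.1)
        (f := fun p : ((X.1 ⟶ Y.1) × (X.2 ⟶ Y.2)) × ((Y.1 ⟶ Z.1) × (Y.2 ⟶ Z.2)) => p.1.1)
        (g := fun p => p.2.1) (ScottContinuous.fst.comp ScottContinuous.fst)
        (ScottContinuous.snd.comp ScottContinuous.fst))
      (scottContinuous_comp (X := X.2) (Y := Y.2) (Z := Z.2)
        (f := fun p : ((X.1 ⟶ Y.1) × (X.2 ⟶ Y.2)) × ((Y.1 ⟶ Z.1) × (Y.2 ⟶ Z.2)) => p.1.2)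
        (g := fun p => p.2.2) (ScottContinuous.fst.comp ScottContinuous.snd)
        (ScottContinuous.snd.comp ScottContinuous.snd))

theorem scottContinuous_pi {α : Type*} [Preorder α] {ι : Type*} {π : ι → Type*}
    [∀ i, Preorder (π i)] {f : α → ∀ i, π i} (h : ∀ i, ScottContinuous fun a => f a i) :
    ScottContinuous f := by
  intro d hd hd' a ha
  refine isLUB_pi.2 fun i => ?_
  have := h i hd hd' ha
  rwa [Set.image_image]

theorem scottContinuous_eval {ι : Type*} {π : ι → Type*} [∀ i, Preorder (π i)] (i : ι) :
    ScottContinuous fun f : ∀ i, π i => f i :=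
  fun _ _ _ _ ha => isLUB_pi.1 ha i

instance piOCategory {ι : Type} {D : Type u₂} [Category.{v₂} D] [OCategory D] :
    OCategory (ι → D) where
  homOrder X Y := Pi.partialOrder (ι := ι) (π := fun i => X i ⟶ Y i)
  exists_isLUB {X Y} s hs hd := by
    have h : ∀ i, ∃ f, IsLUB (Function.eval i '' (s : Set (∀ i, X i ⟶ Y i))) f := fun i =>
      OCategory.exists_isLUB _ (hs.image _) (by
        rintro _ ⟨a, ha, rfl⟩ _ ⟨b, hb, rfl⟩
        obtain ⟨c, hc, hac, hbc⟩ := hd a ha b hb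
        exact ⟨_, ⟨c, hc, rfl⟩, hac i, hbc i⟩)
    choose f hf using h
    exact ⟨f, isLUB_pi.2 hf⟩
  comp_continuous X Y Z :=
    scottContinuous_pi (α := (∀ i, X i ⟶ Y i) × (∀ i, Y i ⟶ Z i)) fun i =>
      scottContinuous_comp (ScottContinuous.fst.comp (scottContinuous_eval i))
        (ScottContinuous.snd.comp (scottContinuous_eval i))

/-- Locally continuous functors between O-categories. -/
structure LCFunctor (C : Type u₁) [Category.{v₁} C] [OCategory C]
    (D : Type u₂) [Category.{v₂} D] [OCategory D] extends C ⥤ D where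
  scottContinuous_map : ∀ X Y : C, ScottContinuous fun f : X ⟶ Y => toFunctor.map f

namespace LCFunctor

variable {C : Type u₁} [Category.{v₁} C] [OCategory C]
  {D : Type u₂} [Category.{v₂} D] [OCategory D]
  {E : Type u₃} [Category.{v₃} E] [OCategory E]

theorem map_isEPPair (F : LCFunctor C D) {X Y : C} {e : X ⟶ Y} {p : Y ⟶ X} (h : IsEPPair e p) :
    IsEPPair (F.map e) (F.map p) where
  comp_eq := by rw [← F.map_comp, h.comp_eq, F.map_id]
  comp_le := by
    rw [← F.map_comp, ← F.map_id]
    exact (F.scottContinuous_map Y Y).monotone h.comp_le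

/-- Composition, in diagrammatic order: `F` first. -/
def comp (F : LCFunctor C D) (G : LCFunctor D E) : LCFunctor C E where
  toFunctor := F.toFunctor ⋙ G.toFunctor
  scottContinuous_map X Y :=
    (F.scottContinuous_map X Y).comp (G.scottContinuous_map (F.obj X) (F.obj Y))

/-- The projection functors out of a power. -/
def eval {ι : Type} (i : ι) : LCFunctor (ι → D) D where
  toFunctor := Pi.eval (fun _ => D) i
  scottContinuous_map X Y := scottContinuous_eval (π := fun i => X i ⟶ Y i) i

/-- The tuple of a family of functors. -/
def tuple {ι : Type} (F : ι → LCFunctor C D) : LCFunctor C (ι → D) where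
  toFunctor := Functor.pi' fun i => (F i).toFunctor
  scottContinuous_map X Y :=
    scottContinuous_pi (π := fun i => (F i).obj X ⟶ (F i).obj Y)
      fun i => (F i).scottContinuous_map X Y

variable (C D) in
/-- First projection. -/
def fst : LCFunctor (C × D) C where
  toFunctor := CategoryTheory.Prod.fst C D
  scottContinuous_map X Y :=
    ScottContinuous.fst (α := X.1 ⟶ Y.1) (β := X.2 ⟶ Y.2)

variable (C D) in
/-- Second projection. -/
def snd : LCFunctor (C × D) D where
  toFunctor := CategoryTheory.Prod.snd C D
  scottContinuous_map X Y :=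
    ScottContinuous.snd (α := X.1 ⟶ Y.1) (β := X.2 ⟶ Y.2)

variable (D) in
/-- The isomorphism of categories `D^n × D → D^(n+1)`. The last factor on the left becomes the
component with index `0` on the right, the `i`-th component of the first factor the component
with index `i + 1`. -/
def extend (n : ℕ) : LCFunctor ((Fin n → D) × D) (Fin (n + 1) → D) :=
  tuple (Fin.cases (snd _ _) fun i => (fst _ _).comp (eval i))

/-- The partial application `F_X = F(X, -)`. -/
def partialApp (F : LCFunctor (D × E) E) (X : D) : LCFunctor E E where
  toFunctor := (Functor.curry.obj F.toFunctor).obj X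
  scottContinuous_map Y Z :=
    ScottContinuous.comp (α := Y ⟶ Z) (β := (X ⟶ X) × (Y ⟶ Z)) (f := fun g => (𝟙 X, g))
      (ScottContinuous.prodMk (ScottContinuous.const (𝟙 X)) ScottContinuous.id)
      (F.scottContinuous_map (X, Y) (X, Z))

end LCFunctor

/-! ## Canonical fixed points -/

section Fix

variable {E : Type u} [Category.{v} E]

/-- `F^n X` -/
def iterObj (F : E ⥤ E) (X : E) : ℕ → E
  | 0 => X
  | n + 1 => F.obj (iterObj F X n)

/-- `F^n k : F^n X ⟶ F^(n+1) X` -/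
def iterLink (F : E ⥤ E) {X : E} (k : X ⟶ F.obj X) :
    ∀ n : ℕ, iterObj F X n ⟶ iterObj F X (n + 1)
  | 0 => k
  | n + 1 => F.map (iterLink F k n)

/-- The component at `X` of the horizontal iterate `η^(n) : F^n ⟶ G^n`, where
`η^(n+1) = η ∗ η^(n)`. -/
def iterTrans {F G : E ⥤ E} (η : F ⟶ G) (X : E) : ∀ n : ℕ, iterObj F X n ⟶ iterObj G X n
  | 0 => 𝟙 X
  | n + 1 => F.map (iterTrans η X n) ≫ η.app (iterObj G X n)

theorem iterTrans_id (F : E ⥤ E) (X : E) (n : ℕ) : iterTrans (𝟙 F) X n = 𝟙 _ := by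
  induction n with
  | zero => rfl
  | succ n ih =>
    change F.map (iterTrans (𝟙 F) X n) ≫ 𝟙 (F.obj (iterObj F X n)) = 𝟙 (F.obj (iterObj F X n))
    rw [ih, F.map_id, Category.comp_id]

theorem iterTrans_comp {F G H : E ⥤ E} (η : F ⟶ G) (θ : G ⟶ H) (X : E) (n : ℕ) :
    iterTrans (η ≫ θ) X n = iterTrans η X n ≫ iterTrans θ X n := by
  induction n with
  | zero => exact (Category.id_comp _).symm
  | succ n ih =>
    change F.map (iterTrans (η ≫ θ) X n) ≫ η.app _ ≫ θ.app _ =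
      (F.map _ ≫ η.app _) ≫ G.map _ ≫ θ.app _
    rw [ih, F.map_comp]
    simp only [Category.assoc, NatTrans.naturality_assoc]

variable [OCategory E] (c : FixChoice E)

variable {c} in
theorem iterLink_iterTrans {F G : LCFunctor E E} (η : F.toFunctor ⟶ G.toFunctor) (n : ℕ) :
    iterLink F.toFunctor (c.isInitial.to (F.obj c.bot)) n ≫ iterTrans η c.bot (n + 1) =
      iterTrans η c.bot n ≫ iterLink G.toFunctor (c.isInitial.to (G.obj c.bot)) n := by
  induction n with
  | zero => exact c.isInitial.hom_ext _ _
  | succ n ih =>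
    change F.map _ ≫ F.map _ ≫ η.app _ = (F.map _ ≫ η.app _) ≫ G.map _
    rw [← F.map_comp_assoc, ih, F.map_comp, Category.assoc, Category.assoc, η.naturality]

variable [Limits.HasZeroMorphisms E] [HasStrictMorphisms E]

theorem isEmbedding_to (X : E) : IsEmbedding (c.isInitial.to X) :=
  ⟨0, c.isInitial.hom_ext _ _, by
    rw [Limits.zero_comp]; exact HasStrictMorphisms.zero_le _⟩

theorem isEmbedding_iterLink (F : LCFunctor E E) (n : ℕ) :
    IsEmbedding (iterLink F.toFunctor (c.isInitial.to (F.obj c.bot)) n) := by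
  induction n with
  | zero => exact isEmbedding_to c _
  | succ n ih => exact ⟨_, F.map_isEPPair ih.isEPPair⟩

/-- The chain `⊥ ⟶ F ⊥ ⟶ F² ⊥ ⟶ ⋯`. -/
def fixChain (F : LCFunctor E E) : EmbChain E where
  functor := Functor.ofSequence (iterLink F.toFunctor (c.isInitial.to (F.obj c.bot)))
  isEmbedding {m n} f := by
    obtain ⟨k, rfl⟩ := Nat.exists_eq_add_of_le (leOfHom f)
    obtain rfl := Subsingleton.elim f (homOfLE (Nat.le_add_right m k))
    induction k with
    | zero => exact ⟨𝟙 _, by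
        have : homOfLE (Nat.le_add_right m 0) = 𝟙 m := rfl
        rw [this, CategoryTheory.Functor.map_id]; exact IsEPPair.id _⟩
    | succ k ih =>
      have : homOfLE (Nat.le_add_right m (k + 1)) =
        homOfLE (Nat.le_add_right m k) ≫ homOfLE (Nat.le_add_right (m + k) 1) := rfl
      rw [this, Functor.map_comp, Functor.ofSequence_map_homOfLE_succ]
      exact ih.comp (isEmbedding_iterLink c F _)

/-- The canonical fixed point of `F`. -/
def fixObj (F : LCFunctor E E) : E := (c.colim (fixChain c F)).cocone.pt

/-- The legs `κ_n : F^n ⊥ ⟶ FIX F` of the chosen O-colimit. -/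
def fixLeg (F : LCFunctor E E) (n : ℕ) : iterObj F.toFunctor c.bot n ⟶ fixObj c F :=
  (c.colim (fixChain c F)).cocone.ι.app n

theorem isEmbedding_fixLeg (F : LCFunctor E E) (n : ℕ) : IsEmbedding (fixLeg c F n) :=
  (c.colim (fixChain c F)).isEmbedding n

/-- The projections `κ_n^p : FIX F ⟶ F^n ⊥`. -/
noncomputable def fixProj (F : LCFunctor E E) (n : ℕ) :
    fixObj c F ⟶ iterObj F.toFunctor c.bot n :=
  (isEmbedding_fixLeg c F n).proj

theorem isEPPair_fix (F : LCFunctor E E) (n : ℕ) : IsEPPair (fixLeg c F n) (fixProj c F n) :=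
  (isEmbedding_fixLeg c F n).isEPPair

theorem iterLink_fixLeg (F : LCFunctor E E) (n : ℕ) :
    iterLink F.toFunctor (c.isInitial.to (F.obj c.bot)) n ≫ fixLeg c F (n + 1) = fixLeg c F n := by
  have h := (c.colim (fixChain c F)).cocone.w (homOfLE (Nat.le_add_right n 1))
  have h' : (fixChain c F).functor.map (homOfLE (Nat.le_add_right n 1)) =
    iterLink F.toFunctor (c.isInitial.to (F.obj c.bot)) n :=
    Functor.ofSequence_map_homOfLE_succ _ n
  rw [h'] at h
  exact h

/-- `γ_n ∘ η^(n) ∘ φ_n^p : FIX F ⟶ FIX G`, where `φ` and `γ` are the chosen O-colimits. -/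
noncomputable def fixApprox {F G : LCFunctor E E} (η : F.toFunctor ⟶ G.toFunctor) (n : ℕ) :
    fixObj c F ⟶ fixObj c G :=
  fixProj c F n ≫ iterTrans η c.bot n ≫ fixLeg c G n

theorem monotone_fixApprox {F G : LCFunctor E E} (η : F.toFunctor ⟶ G.toFunctor) :
    Monotone (fixApprox c η) := by
  refine monotone_nat_of_le_succ fun n => ?_
  obtain ⟨p, hp⟩ := isEmbedding_iterLink c F n
  have h : fixProj c F n = fixProj c F (n + 1) ≫ p := by
    have h1 := hp.comp (isEPPair_fix c F (n + 1))
    rw [iterLink_fixLeg] at h1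
    exact (isEPPair_fix c F n).unique h1
  calc fixApprox c η n
      = fixProj c F (n + 1) ≫ (p ≫ iterLink F.toFunctor (c.isInitial.to (F.obj c.bot)) n) ≫
          iterTrans η c.bot (n + 1) ≫ fixLeg c G (n + 1) := by
        rw [fixApprox, h, ← iterLink_fixLeg c G]
        simp only [Category.assoc]
        rw [← Category.assoc (iterLink _ _ n), iterLink_iterTrans, Category.assoc]
    _ ≤ fixProj c F (n + 1) ≫ 𝟙 _ ≫ iterTrans η c.bot (n + 1) ≫ fixLeg c G (n + 1) :=
        comp_mono le_rfl (comp_mono hp.comp_le le_rfl)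
    _ = fixApprox c η (n + 1) := by rw [Category.id_comp]; rfl

theorem exists_isLUB_fixApprox {F G : LCFunctor E E} (η : F.toFunctor ⟶ G.toFunctor) :
    ∃ f, IsLUB (Set.range (fixApprox c η)) f :=
  OCategory.exists_isLUB _ (Set.range_nonempty _)
    (monotone_fixApprox c η).directed_le.directedOn_range

/-- `FIX η = ⨆ n, γ_n ∘ η^(n) ∘ φ_n^p`. -/
noncomputable def fixMap {F G : LCFunctor E E} (η : F.toFunctor ⟶ G.toFunctor) :
    fixObj c F ⟶ fixObj c G :=
  Classical.choose (exists_isLUB_fixApprox c η)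

theorem isLUB_fixMap {F G : LCFunctor E E} (η : F.toFunctor ⟶ G.toFunctor) :
    IsLUB (Set.range (fixApprox c η)) (fixMap c η) :=
  Classical.choose_spec (exists_isLUB_fixApprox c η)

theorem fixMap_id (F : LCFunctor E E) : fixMap c (𝟙 F.toFunctor) = 𝟙 (fixObj c F) := by
  refine (isLUB_fixMap c _).unique ?_
  have h := (c.colim (fixChain c F)).isLUB
  have hn : fixApprox c (𝟙 F.toFunctor) = fun n => fixProj c F n ≫ fixLeg c F n := by
    funext n
    rw [fixApprox, iterTrans_id, Category.id_comp]
  rw [hn]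
  exact h

theorem fixMap_comp {F G H : LCFunctor E E} (η : F.toFunctor ⟶ G.toFunctor)
    (θ : G.toFunctor ⟶ H.toFunctor) : fixMap c (η ≫ θ) = fixMap c η ≫ fixMap c θ := by
  refine (isLUB_fixMap c _).unique ?_
  have hl : IsLUB (Set.range fun n => (fixApprox c η n, fixApprox c θ n))
      (fixMap c η, fixMap c θ) := by
    refine isLUB_prod.2 ⟨?_, ?_⟩
    · rw [← Set.range_comp]; exact isLUB_fixMap c η
    · rw [← Set.range_comp]; exact isLUB_fixMap c θ
  have h := OCategory.comp_continuous _ _ _ (Set.range_nonempty _)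
    ((monotone_fixApprox c η).prodMk (monotone_fixApprox c θ)).directed_le.directedOn_range hl
  rw [← Set.range_comp] at h
  have hn : fixApprox c (η ≫ θ) = fun n => fixApprox c η n ≫ fixApprox c θ n := by
    funext n
    simp only [fixApprox, Category.assoc, iterTrans_comp]
    rw [← Category.assoc (fixLeg c G n), (isEPPair_fix c G n).comp_eq, Category.id_comp]
  rw [hn]
  exact h

end Fix

/-! ## The dagger -/

section Dagger

variable {D : Type u₁} [Category.{v₁} D] [OCategory D]
  {E : Type u} [Category.{v} E] [OCategory E]

/-- `Λ F f : F_X ⟶ F_Y` for `f : X ⟶ Y`. -/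
def partialMap (F : LCFunctor (D × E) E) {X Y : D} (f : X ⟶ Y) :
    (F.partialApp X).toFunctor ⟶ (F.partialApp Y).toFunctor :=
  (Functor.curry.obj F.toFunctor).map f

/-- `(Λ η)_X : F_X ⟶ G_X` for `η : F ⟶ G`. -/
def partialTrans {F G : LCFunctor (D × E) E} (η : F.toFunctor ⟶ G.toFunctor) (X : D) :
    (F.partialApp X).toFunctor ⟶ (G.partialApp X).toFunctor :=
  (Functor.curry.map η).app X

theorem scottContinuous_iterTrans (F : LCFunctor (D × E) E) (X Y : D) (Z : E) (n : ℕ) :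
    ScottContinuous fun f : X ⟶ Y => iterTrans (partialMap F f) Z n := by
  induction n with
  | zero => exact ScottContinuous.const _
  | succ n ih =>
    refine scottContinuous_comp
      (ih.comp ((F.partialApp X).scottContinuous_map _ _)) ?_
    exact ScottContinuous.comp
      (ScottContinuous.prodMk (β := X ⟶ Y) ScottContinuous.id (ScottContinuous.const (𝟙 _)))
      (F.scottContinuous_map _ _)

variable [Limits.HasZeroMorphisms E] [HasStrictMorphisms E] (c : FixChoice E)

/-- The parametrized fixed point `F† : D ⟶ E` of `F : D × E ⟶ E`, with `F† X = FIX F_X`. -/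
noncomputable def dagger (F : LCFunctor (D × E) E) : LCFunctor D E where
  obj X := fixObj c (F.partialApp X)
  map f := fixMap c (partialMap F f)
  map_id X := by
    have h : partialMap F (𝟙 X) = 𝟙 (F.partialApp X).toFunctor :=
      (Functor.curry.obj F.toFunctor).map_id X
    rw [h, fixMap_id]
  map_comp {X Y Z} f g := by
    have h : partialMap F (f ≫ g) = partialMap F f ≫ partialMap F g :=
      (Functor.curry.obj F.toFunctor).map_comp f g
    rw [h, fixMap_comp]
  scottContinuous_map X Y := by
    have hc : ∀ n, ScottContinuous fun f : X ⟶ Y => fixApprox c (partialMap F f) n := fun n =>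
      scottContinuous_comp (ScottContinuous.const _)
        (scottContinuous_comp (scottContinuous_iterTrans F X Y c.bot n) (ScottContinuous.const _))
    intro s hs hd f hf
    constructor
    · rintro _ ⟨g, hg, rfl⟩
      refine (isLUB_fixMap c _).2 ?_
      rintro _ ⟨n, rfl⟩
      exact ((hc n).monotone (hf.1 hg)).trans ((isLUB_fixMap c (partialMap F f)).1 ⟨n, rfl⟩)
    · intro b hb
      refine (isLUB_fixMap c _).2 ?_
      rintro _ ⟨n, rfl⟩
      refine (hc n hs hd hf).2 ?_
      rintro _ ⟨g, hg, rfl⟩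
      exact ((isLUB_fixMap c (partialMap F g)).1 ⟨n, rfl⟩).trans (hb ⟨g, hg, rfl⟩)

/-- The action of the dagger on natural transformations: `(η†)_X = FIX ((Λ η)_X)`. -/
noncomputable def daggerMap {F G : LCFunctor (D × E) E} (η : F.toFunctor ⟶ G.toFunctor) :
    (dagger c F).toFunctor ⟶ (dagger c G).toFunctor where
  app X := fixMap c (partialTrans η X)
  naturality X Y f := by
    change fixMap c (partialMap F f) ≫ fixMap c (partialTrans η Y) =
      fixMap c (partialTrans η X) ≫ fixMap c (partialMap G f)
    rw [← fixMap_comp, ← fixMap_comp]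
    congr 1
    exact (Functor.curry.map η).naturality f

end Dagger

/-! ## The O-category of Scott domains -/

/-- Scott domains: pointed bounded-complete algebraic dcpos with countably many compact elements. -/
class IsScottDomain (D : Type u) [PartialOrder D] [OrderBot D] : Prop where
  directedComplete : ∀ s : Set D, s.Nonempty → DirectedOn (· ≤ ·) s → ∃ x, IsLUB s x
  boundedComplete : ∀ s : Set D, BddAbove s → ∃ x, IsLUB s x
  directedOn_compact : ∀ x : D, DirectedOn (· ≤ ·) {k : D | IsCompactElement k ∧ k ≤ x}
  isLUB_compact : ∀ x : D, IsLUB {k : D | IsCompactElement k ∧ k ≤ x} x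
  countable_compact : {k : D | IsCompactElement k}.Countable

/-- The objects of the category `M`. -/
structure ScottDom : Type (u + 1) where
  carrier : Type u
  [partialOrder : PartialOrder carrier]
  [orderBot : OrderBot carrier]
  [isScottDomain : IsScottDomain carrier]

namespace ScottDom

instance : CoeSort ScottDom.{u} (Type u) := ⟨carrier⟩

attribute [instance] partialOrder orderBot isScottDomain

/-- The morphisms of `M`: strict continuous functions that preserve binary meets (in a Scott
domain all binary meets exist). -/
@[ext]
structure Hom (D E : ScottDom.{u}) where
  toFun : D → E
  strict : toFun ⊥ = ⊥
  continuous : ScottContinuous toFun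
  map_meet : ∀ x y z : D, IsGLB {x, y} z → IsGLB {toFun x, toFun y} (toFun z)

instance : Category ScottDom.{u} where
  Hom := Hom
  id D := ⟨fun x => x, rfl, ScottContinuous.id, fun _ _ _ h => h⟩
  comp f g :=
    { toFun := fun x => g.toFun (f.toFun x)
      strict := by rw [f.strict, g.strict]
      continuous := f.continuous.comp g.continuous
      map_meet := fun _ _ _ h => g.map_meet _ _ _ (f.map_meet _ _ _ h) }

theorem hom_ext {D E : ScottDom.{u}} {f g : D ⟶ E} (h : ∀ x, f.toFun x = g.toFun x) : f = g :=
  Hom.ext (funext h)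

/-- Morphisms are ordered pointwise. -/
@[reducible]
def homOrder (D E : ScottDom.{u}) : PartialOrder (D ⟶ E) :=
  PartialOrder.lift (fun f => f.toFun) fun _ _ h => Hom.ext h

theorem exists_isLUB_hom {D E : ScottDom.{u}} (s : Set (D ⟶ E)) (hs : s.Nonempty)
    (hd : DirectedOn (homOrder D E).le s) :
    ∃ f : D ⟶ E, ∀ x, IsLUB ((fun g : D ⟶ E => g.toFun x) '' s) (f.toFun x) := by
  have h : ∀ x : D, ∃ y : E, IsLUB ((fun g : D ⟶ E => g.toFun x) '' s) y := fun x =>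
    IsScottDomain.directedComplete _ (hs.image _) (by
      rintro _ ⟨a, ha, rfl⟩ _ ⟨b, hb, rfl⟩
      obtain ⟨c, hc, hac, hbc⟩ := hd a ha b hb
      exact ⟨_, ⟨c, hc, rfl⟩, hac x, hbc x⟩)
  choose F hF using h
  have mono : Monotone F := fun x y hxy => (hF x).2 (by
    rintro _ ⟨g, hg, rfl⟩
    exact (g.continuous.monotone hxy).trans ((hF y).1 ⟨g, hg, rfl⟩))
  refine ⟨⟨F, ?_, ?_, ?_⟩, hF⟩
  · refine le_antisymm ((hF ⊥).2 ?_) bot_le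
    rintro _ ⟨g, hg, rfl⟩
    exact g.strict.le
  · intro d hd₁ hd₂ a ha
    refine ⟨mono.mem_upperBounds_image ha.1, fun b hb => (hF a).2 ?_⟩
    rintro _ ⟨g, hg, rfl⟩
    refine (g.continuous hd₁ hd₂ ha).2 ?_
    rintro _ ⟨x, hx, rfl⟩
    exact ((hF x).1 ⟨g, hg, rfl⟩).trans (hb ⟨x, hx, rfl⟩)
  · intro x y z hz
    have dir : ∀ x : D, DirectedOn (· ≤ ·) ((fun g : D ⟶ E => g.toFun x) '' s) := by
      rintro x _ ⟨a, ha, rfl⟩ _ ⟨b, hb, rfl⟩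
      obtain ⟨c, hc, hac, hbc⟩ := hd a ha b hb
      exact ⟨_, ⟨c, hc, rfl⟩, hac x, hbc x⟩
    constructor
    · rintro _ (rfl | rfl)
      · exact mono (hz.1 (by simp))
      · exact mono (hz.1 (by simp))
    · intro w hw
      refine (IsScottDomain.isLUB_compact w).2 ?_
      rintro k ⟨hk, hkw⟩
      have hx : k ≤ F x := hkw.trans (hw (by simp))
      have hy : k ≤ F y := hkw.trans (hw (by simp))
      obtain ⟨_, ⟨a, ha, rfl⟩, hka⟩ := hk _ _ (hs.image _) (dir x) (hF x) hx
      obtain ⟨_, ⟨b, hb, rfl⟩, hkb⟩ := hk _ _ (hs.image _) (dir y) (hF y) hy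
      obtain ⟨c, hc, hac, hbc⟩ := hd a ha b hb
      refine le_trans ((c.map_meet x y z hz).2 ?_) ((hF z).1 ⟨c, hc, rfl⟩)
      rintro _ (rfl | rfl)
      · exact hka.trans (hac x)
      · exact hkb.trans (hbc y)

theorem isLUB_hom_iff {D E : ScottDom.{u}} {s : Set (D ⟶ E)} (hs : s.Nonempty)
    (hd : DirectedOn (homOrder D E).le s) {f : D ⟶ E} :
    @IsLUB _ (homOrder D E).toLE s f ↔
      ∀ x, IsLUB ((fun g : D ⟶ E => g.toFun x) '' s) (f.toFun x) := by
  have key : ∀ g : D ⟶ E, (∀ x, IsLUB ((fun g : D ⟶ E => g.toFun x) '' s) (g.toFun x)) →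
      @IsLUB _ (homOrder D E).toLE s g := fun g hg => by
    refine ⟨fun a ha x => (hg x).1 ⟨a, ha, rfl⟩, fun b hb x => (hg x).2 ?_⟩
    rintro _ ⟨a, ha, rfl⟩
    exact hb ha x
  refine ⟨fun hf => ?_, key f⟩
  obtain ⟨g, hg⟩ := exists_isLUB_hom s hs hd
  have : f = g := @IsLUB.unique _ (homOrder D E) _ _ _ hf (key g hg)
  rwa [this]

instance : OCategory ScottDom.{u} where
  homOrder := homOrder
  exists_isLUB s hs hd := by
    obtain ⟨f, hf⟩ := exists_isLUB_hom s hs hd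
    exact ⟨f, (isLUB_hom_iff hs hd).2 hf⟩
  comp_continuous X Y Z := by
    let _ := homOrder X Y
    let _ := homOrder Y Z
    let _ := homOrder X Z
    refine ScottContinuous.fromProd (fun f => ?_) (fun g => ?_)
    · intro s hs hd g hg
      have mono : Monotone fun g : Y ⟶ Z => f ≫ g := fun a b hab x => hab (f.toFun x)
      refine (isLUB_hom_iff (hs.image _) (hd.mono_comp (fun {_ _} h => mono h))).2 fun x => ?_
      have := (isLUB_hom_iff hs hd).1 hg (f.toFun x)
      rwa [Set.image_image]
    · intro s hs hd f hf
      have mono : Monotone fun f : X ⟶ Y => f ≫ g :=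
        fun a b hab x => g.continuous.monotone (hab x)
      refine (isLUB_hom_iff (hs.image _) (hd.mono_comp (fun {_ _} h => mono h))).2 fun x => ?_
      have h := g.continuous (hs.image _) ?_ ((isLUB_hom_iff hs hd).1 hf x)
      · rw [Set.image_image] at h ⊢
        exact h
      · rintro _ ⟨a, ha, rfl⟩ _ ⟨b, hb, rfl⟩
        obtain ⟨c, hc, hac, hbc⟩ := hd a ha b hb
        exact ⟨_, ⟨c, hc, rfl⟩, hac x, hbc x⟩

instance : Limits.HasZeroMorphisms ScottDom.{u} where
  zero D E := ⟨⟨fun _ => ⊥, rfl, ScottContinuous.const ⊥, fun _ _ _ _ => by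
    rw [Set.pair_eq_singleton]; exact isGLB_singleton⟩⟩
  comp_zero _ _ := rfl
  zero_comp _ _ _ g := hom_ext fun _ => g.strict

instance : HasStrictMorphisms ScottDom.{u} where
  zero_le _ := fun _ => bot_le

/-! ### Binary products in `M` -/

theorem isCompactElement_prod_iff {D E : Type u} [PartialOrder D] [PartialOrder E] (k : D × E) :
    IsCompactElement k ↔ IsCompactElement k.1 ∧ IsCompactElement k.2 := by
  constructor
  · intro h
    constructor
    · intro s a hs hd ha hk
      obtain ⟨x, hx, hkx⟩ := h (s ×ˢ {k.2}) (a, k.2) (hs.prod (Set.singleton_nonempty _))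
        (hd.prod (directedOn_singleton _)) (ha.prod hs (Set.singleton_nonempty _) isLUB_singleton)
        ⟨hk, le_rfl⟩
      exact ⟨x.1, hx.1, hkx.1⟩
    · intro s a hs hd ha hk
      obtain ⟨x, hx, hkx⟩ := h ({k.1} ×ˢ s) (k.1, a) ((Set.singleton_nonempty _).prod hs)
        ((directedOn_singleton _).prod hd) (isLUB_singleton.prod (Set.singleton_nonempty _) hs ha)
        ⟨le_rfl, hk⟩
      exact ⟨x.2, hx.2, hkx.2⟩
  · rintro ⟨h1, h2⟩ s a hs hd ha hk
    obtain ⟨_, ⟨x, hx, rfl⟩, hkx⟩ := h1 _ _ (hs.image _) hd.fst (isLUB_prod.1 ha).1 hk.1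
    obtain ⟨_, ⟨y, hy, rfl⟩, hky⟩ := h2 _ _ (hs.image _) hd.snd (isLUB_prod.1 ha).2 hk.2
    obtain ⟨z, hz, hxz, hyz⟩ := hd x hx y hy
    exact ⟨z, hz, hkx.trans hxz.1, hky.trans hyz.2⟩

theorem setOf_compact_prod {D E : Type u} [PartialOrder D] [PartialOrder E] (x : D × E) :
    {k : D × E | IsCompactElement k ∧ k ≤ x} =
      {k : D | IsCompactElement k ∧ k ≤ x.1} ×ˢ {k : E | IsCompactElement k ∧ k ≤ x.2} := by
  ext k
  simp only [Set.mem_prod, Set.mem_ofPred_eq, isCompactElement_prod_iff, Prod.le_def]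
  tauto

theorem isCompactElement_bot {D : Type u} [PartialOrder D] [OrderBot D] :
    IsCompactElement (⊥ : D) := fun _ _ hs _ _ _ => hs.imp fun _ hx => ⟨hx, bot_le⟩

instance isScottDomain_prod {D E : Type u} [PartialOrder D] [OrderBot D] [IsScottDomain D]
    [PartialOrder E] [OrderBot E] [IsScottDomain E] : IsScottDomain (D × E) where
  directedComplete s hs hd := by
    obtain ⟨x, hx⟩ := IsScottDomain.directedComplete _ (hs.image Prod.fst) hd.fst
    obtain ⟨y, hy⟩ := IsScottDomain.directedComplete _ (hs.image Prod.snd) hd.snd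
    exact ⟨(x, y), isLUB_prod.2 ⟨hx, hy⟩⟩
  boundedComplete s hs := by
    obtain ⟨x, hx⟩ := IsScottDomain.boundedComplete _ (monotone_fst.map_bddAbove hs)
    obtain ⟨y, hy⟩ := IsScottDomain.boundedComplete _ (monotone_snd.map_bddAbove hs)
    exact ⟨(x, y), isLUB_prod.2 ⟨hx, hy⟩⟩
  directedOn_compact x := by
    rw [setOf_compact_prod]
    exact (IsScottDomain.directedOn_compact x.1).prod (IsScottDomain.directedOn_compact x.2)
  isLUB_compact x := by
    rw [setOf_compact_prod]
    exact (IsScottDomain.isLUB_compact x.1).prod ⟨⊥, isCompactElement_bot, bot_le⟩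
      ⟨⊥, isCompactElement_bot, bot_le⟩ (IsScottDomain.isLUB_compact x.2)
  countable_compact :=
    (IsScottDomain.countable_compact.prod IsScottDomain.countable_compact).mono
      fun k hk => (isCompactElement_prod_iff k).1 hk

theorem isGLB_pair_prod {D E : Type u} [PartialOrder D] [PartialOrder E] {x y z : D × E} :
    IsGLB {x, y} z ↔ IsGLB {x.1, y.1} z.1 ∧ IsGLB {x.2, y.2} z.2 := by
  rw [isGLB_prod, Set.image_pair, Set.image_pair]

/-- The product of two Scott domains, ordered componentwise. -/
def prod (D E : ScottDom.{u}) : ScottDom.{u} := ⟨D × E⟩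

/-- First projection. -/
def fst (D E : ScottDom.{u}) : prod D E ⟶ D where
  toFun x := x.1
  strict := rfl
  continuous := ScottContinuous.fst (α := D) (β := E)
  map_meet _ _ _ h := (isGLB_pair_prod.1 h).1

/-- Second projection. -/
def snd (D E : ScottDom.{u}) : prod D E ⟶ E where
  toFun x := x.2
  strict := rfl
  continuous := ScottContinuous.snd (α := D) (β := E)
  map_meet _ _ _ h := (isGLB_pair_prod.1 h).2

/-- The pairing `⟨f, g⟩`. -/
def lift {C D E : ScottDom.{u}} (f : C ⟶ D) (g : C ⟶ E) : C ⟶ prod D E where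
  toFun x := (f.toFun x, g.toFun x)
  strict := Prod.ext f.strict g.strict
  continuous := f.continuous.prodMk g.continuous
  map_meet x y z h := isGLB_pair_prod.2 ⟨f.map_meet x y z h, g.map_meet x y z h⟩

end ScottDom

/-! ## Session types -/

/-- Recursive session types in the context of `n` type variables, up to renaming of bound
variables (de Bruijn indices): `var i` is the rule CVar, `mu A` is `ρα.A`, where `α` is the variable
with index `0` of `A`, and the variables of the context of `mu A` are shifted by one in `A`. -/
inductive SessionType : ℕ → Type
  | var {n : ℕ} (i : Fin n) : SessionType n
  | mu {n : ℕ} (A : SessionType (n + 1)) : SessionType n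

namespace SessionType

/-- Renaming of free variables. -/
def rename : {n m : ℕ} → SessionType n → (Fin n → Fin m) → SessionType m
  | _, _, var i, r => var (r i)
  | _, _, mu A, r => mu (A.rename (Fin.cases 0 fun i => (r i).succ))

/-- The capture-avoiding simultaneous substitution `[B_1, …, B_n / α_1, …, α_n] A`. -/
def subst : {n m : ℕ} → SessionType n → (Fin n → SessionType m) → SessionType m
  | _, _, var i, B => B i
  | _, _, mu A, B => mu (A.subst (Fin.cases (var 0) fun i => (B i).rename Fin.succ))

end SessionType

/-! ## Interpretations -/

section Interpretation

/-- The interpretation of a context of `n` type variables: the power `M^n`. -/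
abbrev Ctx (n : ℕ) : Type (u + 1) := Fin n → ScottDom.{u}

variable {C : Type u₁} [Category.{v₁} C]

/-- The product `F × G : C ⟶ M` of two functors to `M`. -/
def prodFunctor (F G : C ⥤ ScottDom.{u}) : C ⥤ ScottDom.{u} where
  obj X := ScottDom.prod (F.obj X) (G.obj X)
  map f := ScottDom.lift (ScottDom.fst _ _ ≫ F.map f) (ScottDom.snd _ _ ≫ G.map f)
  map_id X := ScottDom.hom_ext fun x => by
    rw [F.map_id, G.map_id]; rfl
  map_comp f g := ScottDom.hom_ext fun x => by
    rw [F.map_comp, G.map_comp]; rfl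

/-- `π_1 : F × G ⟶ F` -/
def prodFst (F G : C ⥤ ScottDom.{u}) : prodFunctor F G ⟶ F where
  app _ := ScottDom.fst _ _
  naturality _ _ _ := rfl

/-- `π_2 : F × G ⟶ G` -/
def prodSnd (F G : C ⥤ ScottDom.{u}) : prodFunctor F G ⟶ G where
  app _ := ScottDom.snd _ _
  naturality _ _ _ := rfl

/-- The pairing `⟨η, θ⟩ : H ⟶ F × G` of natural transformations. -/
def prodLift {F G H : C ⥤ ScottDom.{u}} (η : H ⟶ F) (θ : H ⟶ G) : H ⟶ prodFunctor F G where
  app X := ScottDom.lift (η.app X) (θ.app X)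
  naturality _ _ f := ScottDom.hom_ext fun x =>
    Prod.ext (congrArg (fun h => h.toFun x) (η.naturality f))
      (congrArg (fun h => h.toFun x) (θ.naturality f))

/-- The tuple of a family of natural transformations. -/
def tupleTrans {n : ℕ} {C : Type u₁} [Category.{v₁} C] [OCategory C]
    {D : Type u₂} [Category.{v₂} D] [OCategory D] {F G : Fin n → LCFunctor C D}
    (η : ∀ i, (F i).toFunctor ⟶ (G i).toFunctor) :
    (LCFunctor.tuple F).toFunctor ⟶ (LCFunctor.tuple G).toFunctor :=
  NatTrans.pi' η

/-- What a session type in the context of `n` variables denotes: locally continuous functors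
`⟦A⟧`, `⟦A⟧^-`, `⟦A⟧^+` from `M^n` to `M` and a 2-cell `⟦A⟧ ⟶ ⟦A⟧^- × ⟦A⟧^+`. -/
structure Interp (n : ℕ) where
  bi : LCFunctor (Ctx.{u} n) ScottDom.{u}
  neg : LCFunctor (Ctx.{u} n) ScottDom.{u}
  pos : LCFunctor (Ctx.{u} n) ScottDom.{u}
  cell : bi.toFunctor ⟶ prodFunctor neg.toFunctor pos.toFunctor

/-- The component `π_1 ∘ cell : ⟦A⟧ ⟶ ⟦A⟧^-`. -/
def Interp.cellNeg {n : ℕ} (I : Interp.{u} n) : I.bi.toFunctor ⟶ I.neg.toFunctor :=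
  I.cell ≫ prodFst _ _

/-- The component `π_2 ∘ cell : ⟦A⟧ ⟶ ⟦A⟧^+`. -/
def Interp.cellPos {n : ℕ} (I : Interp.{u} n) : I.bi.toFunctor ⟶ I.pos.toFunctor :=
  I.cell ≫ prodSnd _ _

variable (c : FixChoice ScottDom.{u})

/-- `F†` for `F : M^(n+1) ⟶ M`, viewed as a functor `M^n × M ⟶ M`; the fixed point is taken in the
variable with index `0`. -/
noncomputable def daggerCtx {n : ℕ} (F : LCFunctor (Ctx.{u} (n + 1)) ScottDom.{u}) :
    LCFunctor (Ctx.{u} n) ScottDom.{u} :=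
  dagger c ((LCFunctor.extend ScottDom.{u} n).comp F)

/-- `η†` for a natural transformation `η` of functors `M^(n+1) ⟶ M`. -/
noncomputable def daggerCtxMap {n : ℕ} {F G : LCFunctor (Ctx.{u} (n + 1)) ScottDom.{u}}
    (η : F.toFunctor ⟶ G.toFunctor) : (daggerCtx c F).toFunctor ⟶ (daggerCtx c G).toFunctor :=
  daggerMap c (F := (LCFunctor.extend ScottDom.{u} n).comp F)
    (G := (LCFunctor.extend ScottDom.{u} n).comp G)
    (Functor.whiskerLeft (LCFunctor.extend ScottDom.{u} n).toFunctor η)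

/-- The interpretation of session types, by induction on their derivation. -/
noncomputable def interp : {n : ℕ} → SessionType n → Interp.{u} n
  | _, .var i =>
    { bi := LCFunctor.eval i
      neg := LCFunctor.eval i
      pos := LCFunctor.eval i
      cell := prodLift (𝟙 _) (𝟙 _) }
  | _, .mu A =>
    { bi := daggerCtx c (interp A).bi
      neg := daggerCtx c (interp A).neg
      pos := daggerCtx c (interp A).pos
      cell := prodLift (daggerCtxMap c (interp A).cellNeg) (daggerCtxMap c (interp A).cellPos) }

end Interpretation

end SessionSem

open SessionSem

/-! Fixed points exist by the limit-colimit coincidence. The sequences compatible with the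
projections of a chain of embeddings form a pointed dcpo `LimitSeq`, and each sequence is the
supremum of the images of its coordinates. This approximation carries bounded completeness,
algebraicity and countability over from the stages (`isScottDomain_of_approx`), so the dcpo is a
Scott domain and the vertex of an O-colimit. The one-point domain is initial because morphisms are
strict.

For the embeddings, the two components of a 2-cell are treated first, by induction on the type. If
every component of η is an embedding, so is the map induced on fixed points: with φ and γ the
O-colimits of source and target, its projection is the supremum of φ_n ∘ (η^(n))^p ∘ γ_n^p
(`isEmbedding_fixMap`). The two components are then paired: the binary meet C × C → C is a morphism
of M, right adjoint to the diagonal, so composing it with f^p × g^p gives the projection of ⟨f, g⟩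
(`isEmbedding_lift`).

Substitution rests on strict naturality of the dagger in its parameter: (G ∘ (F × id))† = G† ∘ F.
This holds on the nose, because both sides at X are the fixed point chosen for the same functor G(F
X, -). For 2-cells, functoriality of FIX turns a horizontal composite into the map induced by a
single composite transformation (`dagger_prodRight_comp`). A `Cell` bundles a transformation with
its source and target, so that equations between functors and between transformations become one
equation in one type and need no transport. An induction over types, done first for renamings
because substitution weakens under binders, yields `interp_subst` for any interpretation sending
variables to projections and ρ to the dagger. It is applied to each polarity separately: sources and
targets give the equalities of functors, the whole cells give the equality of 2-cells. -/

namespace SessionSem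

/-! ## Projections along a chain of embeddings -/

namespace EmbChain

variable {K : Type u} [Category.{v} K] [OCategory K] (J : EmbChain K)

/-- The embedding `D_m ⟶ D_n` of the chain. -/
def emb {m n : ℕ} (h : m ≤ n) : J.functor.obj m ⟶ J.functor.obj n :=
  J.functor.map (homOfLE h)

/-- The projection `D_n ⟶ D_m` of the chain. -/
noncomputable def prj {m n : ℕ} (h : m ≤ n) : J.functor.obj n ⟶ J.functor.obj m :=
  (J.isEmbedding (homOfLE h)).proj

theorem isEPPair {m n : ℕ} (h : m ≤ n) : IsEPPair (J.emb h) (J.prj h) :=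
  (J.isEmbedding (homOfLE h)).isEPPair

theorem emb_comp {l m n : ℕ} (h : l ≤ m) (h' : m ≤ n) :
    J.emb h ≫ J.emb h' = J.emb (h.trans h') :=
  (J.functor.map_comp (homOfLE h) (homOfLE h')).symm

theorem emb_self {n : ℕ} (h : n ≤ n) : J.emb h = 𝟙 _ := J.functor.map_id n

/-- Projections are determined by their embeddings, so functoriality of the embeddings passes to
them. -/
theorem prj_comp {l m n : ℕ} (h : l ≤ m) (h' : m ≤ n) :
    J.prj h' ≫ J.prj h = J.prj (h.trans h') := by
  have := (J.isEPPair h).comp (J.isEPPair h')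
  rw [emb_comp] at this
  exact this.unique (J.isEPPair _)

theorem prj_self {n : ℕ} (h : n ≤ n) : J.prj h = 𝟙 _ := by
  have := J.isEPPair h
  rw [emb_self] at this
  exact this.unique (IsEPPair.id _)

/-- The morphism `D_n ⟶ D_m`, for arbitrary `n` and `m`. -/
noncomputable def transit (n m : ℕ) : J.functor.obj n ⟶ J.functor.obj m :=
  J.emb (le_max_left n m) ≫ J.prj (le_max_right n m)

/-- The passage may go through any common later stage: going further up and back down is the
identity. -/
theorem transit_eq {n m k : ℕ} (hn : n ≤ k) (hm : m ≤ k) :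
    J.transit n m = J.emb hn ≫ J.prj hm := by
  have h : max n m ≤ k := max_le hn hm
  rw [transit, ← J.emb_comp (le_max_left n m) h, ← J.prj_comp (le_max_right n m) h,
    Category.assoc, ← Category.assoc (J.emb h), (J.isEPPair h).comp_eq, Category.id_comp]

theorem transit_prj (n : ℕ) {m m' : ℕ} (h : m ≤ m') :
    J.transit n m' ≫ J.prj h = J.transit n m := by
  rw [J.transit_eq (le_max_left n m') (le_max_right n m'),
    J.transit_eq (le_max_left n m') (h.trans (le_max_right n m')), Category.assoc, prj_comp]

theorem emb_transit {n n' : ℕ} (h : n ≤ n') (m : ℕ) :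
    J.emb h ≫ J.transit n' m = J.transit n m := by
  rw [J.transit_eq (le_max_left n' m) (le_max_right n' m),
    J.transit_eq (h.trans (le_max_left n' m)) (le_max_right n' m), ← Category.assoc, emb_comp]

theorem transit_of_le {n m : ℕ} (h : m ≤ n) : J.transit n m = J.prj h := by
  rw [J.transit_eq le_rfl h, emb_self, Category.id_comp]

theorem prj_transit_le {n m k : ℕ} (hn : n ≤ k) (hm : m ≤ k) :
    J.prj hn ≫ J.transit n m ≤ J.prj hm := by
  rw [J.transit_eq hn hm, ← Category.assoc]
  calc (J.prj hn ≫ J.emb hn) ≫ J.prj hm ≤ 𝟙 _ ≫ J.prj hm :=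
        comp_mono (J.isEPPair hn).comp_le le_rfl
    _ = J.prj hm := Category.id_comp _

end EmbChain

/-- An O-colimit from a cocone of embedding-projection pairs. -/
theorem OColimit.nonempty_of_isEPPair {K : Type u} [Category.{v} K] [OCategory K] {J : EmbChain K}
    (P : K) (κ : ∀ n, J.functor.obj n ⟶ P) (π : ∀ n, P ⟶ J.functor.obj n)
    (h : ∀ n, IsEPPair (κ n) (π n)) (w : ∀ {m n : ℕ} (h : m ≤ n), J.emb h ≫ κ n = κ m)
    (hlub : IsLUB (Set.range fun n => π n ≫ κ n) (𝟙 P)) : Nonempty (OColimit J) := by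
  have he : ∀ n, IsEmbedding (κ n) := fun n => ⟨π n, h n⟩
  have hproj : ∀ n, (he n).proj = π n := fun n => (he n).isEPPair.unique (h n)
  have hw : ∀ ⦃m n : ℕ⦄ (f : m ⟶ n),
      J.functor.map f ≫ κ n = κ m ≫ ((Functor.const ℕ).obj P).map f := fun m n f =>
    (w (leOfHom f)).trans (Category.comp_id (κ m)).symm
  refine ⟨⟨⟨P, ⟨κ, hw⟩⟩, he, ?_, ?_⟩⟩
  · intro m n hmn
    change (he m).proj ≫ κ m ≤ (he n).proj ≫ κ n
    -- Uniqueness of projections makes the `π` compatible, so monotonicity need not be assumed.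
    have hπ : π m = π n ≫ J.prj hmn := by
      have := (J.isEPPair hmn).comp (h n)
      rw [w] at this
      exact (h m).unique this
    rw [hproj, hproj, hπ, ← w hmn]
    calc (π n ≫ J.prj hmn) ≫ J.emb hmn ≫ κ n = π n ≫ (J.prj hmn ≫ J.emb hmn) ≫ κ n := by
          simp only [Category.assoc]
      _ ≤ π n ≫ 𝟙 _ ≫ κ n := comp_mono le_rfl (comp_mono (J.isEPPair hmn).comp_le le_rfl)
      _ = π n ≫ κ n := by rw [Category.id_comp]
  · have : (fun n => π n ≫ κ n) =
        fun n => (he n).proj ≫ κ n :=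
      funext fun n => by rw [hproj]
    rw [this] at hlub
    exact hlub

/-! ## Approximation of a dcpo by Scott domains -/

section Approximation

variable {P : Type u} [PartialOrder P] {D : ℕ → Type u} [∀ n, PartialOrder (D n)]
  {κ : ∀ n, D n → P} {π : ∀ n, P → D n}

/-- A lower adjoint preserves compactness when its upper adjoint is Scott continuous. -/
theorem isCompactElement_embedding {n : ℕ} (hκ : Monotone (κ n)) (hπ : ScottContinuous (π n))
    (hid : ∀ x, π n (κ n x) = x) (hle : ∀ x, κ n (π n x) ≤ x) {k : D n}
    (hk : IsCompactElement k) : IsCompactElement (κ n k) := by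
  intro s a hs hd ha hka
  obtain ⟨_, ⟨y, hy, rfl⟩, hky⟩ := hk _ _ (hs.image (π n))
    (hd.mono_comp fun {_ _} h => hπ.monotone h) (hπ hs hd ha)
    ((hid k).ge.trans (hπ.monotone hka))
  exact ⟨y, hy, (hκ hky).trans (hle y)⟩

/-- Converse for elements in the image of `κ n`: a directed family in `D n` is tested in `P` after
applying `κ n`. -/
theorem isCompactElement_projection {n : ℕ} (hκ : ScottContinuous (κ n)) (hπ : Monotone (π n))
    (hid : ∀ x, π n (κ n x) = x) {k : P} (hk : IsCompactElement k) (hfix : κ n (π n k) = k) :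
    IsCompactElement (π n k) := by
  intro s a hs hd ha hka
  obtain ⟨_, ⟨y, hy, rfl⟩, hky⟩ := hk _ _ (hs.image (κ n))
    (hd.mono_comp fun {_ _} h => hκ.monotone h) (hκ hs hd ha)
    (hfix.ge.trans (hκ.monotone hka))
  exact ⟨y, hy, (hπ hky).trans (hid y).le⟩

/-- A compact element is the supremum of its ascending approximations, hence equals one of them and
all later ones. -/
theorem exists_fixed_of_isCompactElement {P : Type u} [PartialOrder P] {D : ℕ → Type u}
    {κ : ∀ n, D n → P} {π : ∀ n, P → D n} (hle : ∀ n x, κ n (π n x) ≤ x)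
    (hmono : ∀ x, Monotone fun n => κ n (π n x))
    (hlub : ∀ x, IsLUB (Set.range fun n => κ n (π n x)) x) {k : P} (hk : IsCompactElement k) :
    ∃ N, ∀ n, N ≤ n → κ n (π n k) = k := by
  obtain ⟨_, ⟨N, rfl⟩, hN⟩ := hk _ _ (Set.range_nonempty _)
    (hmono k).directed_le.directedOn_range (hlub k) le_rfl
  exact ⟨N, fun n hn => (hle n k).antisymm (hN.trans (hmono k hn))⟩

/-- A bounded set has a supremum `a n` at every stage; the `κ n (a n)` ascend, and their supremum is
the one sought. -/
theorem exists_isLUB_of_approx [∀ n, OrderBot (D n)] [∀ n, IsScottDomain (D n)]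
    (hdc : ∀ s : Set P, s.Nonempty → DirectedOn (· ≤ ·) s → ∃ x, IsLUB s x)
    (hκ : ∀ n, Monotone (κ n)) (hπ : ∀ n, Monotone (π n)) (hid : ∀ n x, π n (κ n x) = x)
    (hle : ∀ n x, κ n (π n x) ≤ x) (hmono : ∀ x, Monotone fun n => κ n (π n x))
    (hlub : ∀ x, IsLUB (Set.range fun n => κ n (π n x)) x) (s : Set P) (hs : BddAbove s) :
    ∃ x, IsLUB s x := by
  have h : ∀ n, ∃ a, IsLUB (π n '' s) a := fun n =>
    IsScottDomain.boundedComplete _ ((hπ n).map_bddAbove hs)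
  choose a ha using h
  have amono : Monotone fun n => κ n (a n) := fun n m hnm => by
    -- For x in s, π_n x = π_n κ_n π_n x ≤ π_n κ_m π_m x ≤ π_n κ_m a_m.
    have : a n ≤ π n (κ m (a m)) := (ha n).2 (by
      rintro _ ⟨x, hx, rfl⟩
      rw [← hid n (π n x)]
      exact hπ n ((hmono x hnm).trans (hκ m ((ha m).1 ⟨x, hx, rfl⟩))))
    exact (hκ n this).trans (hle n _)
  obtain ⟨z, hz⟩ := hdc _ (Set.range_nonempty _) amono.directed_le.directedOn_range
  refine ⟨z, fun x hx => (hlub x).2 ?_, fun b hb => hz.2 ?_⟩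
  · rintro _ ⟨n, rfl⟩
    exact (hκ n ((ha n).1 ⟨x, hx, rfl⟩)).trans (hz.1 ⟨n, rfl⟩)
  · rintro _ ⟨n, rfl⟩
    refine (hκ n ((ha n).2 ?_)).trans (hle n b)
    rintro _ ⟨x, hx, rfl⟩
    exact hπ n (hb hx)

/-- A pointed dcpo that is approximated by a sequence of Scott domains is a Scott domain. -/
theorem isScottDomain_of_approx [OrderBot P] [∀ n, OrderBot (D n)] [∀ n, IsScottDomain (D n)]
    (hdc : ∀ s : Set P, s.Nonempty → DirectedOn (· ≤ ·) s → ∃ x, IsLUB s x)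
    (hκ : ∀ n, ScottContinuous (κ n)) (hπ : ∀ n, ScottContinuous (π n))
    (hid : ∀ n x, π n (κ n x) = x) (hle : ∀ n x, κ n (π n x) ≤ x)
    (hmono : ∀ x, Monotone fun n => κ n (π n x))
    (hlub : ∀ x, IsLUB (Set.range fun n => κ n (π n x)) x) : IsScottDomain P where
  directedComplete := hdc
  boundedComplete := exists_isLUB_of_approx hdc (fun n => (hκ n).monotone)
    (fun n => (hπ n).monotone) hid hle hmono hlub
  directedOn_compact x := by
    rintro k ⟨hk, hkx⟩ l ⟨hl, hlx⟩
    obtain ⟨N, hN⟩ := exists_fixed_of_isCompactElement hle hmono hlub hk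
    obtain ⟨M, hM⟩ := exists_fixed_of_isCompactElement hle hmono hlub hl
    have hk' := hN _ (le_max_left N M)
    have hl' := hM _ (le_max_right N M)
    -- Both compact elements come from the common stage `n`, where directedness is known.
    generalize max N M = n at hk' hl'
    obtain ⟨j, ⟨hj, hjx⟩, hkj, hlj⟩ := IsScottDomain.directedOn_compact (π n x)
      _ ⟨isCompactElement_projection (hκ n) (hπ n).monotone (hid n) hk hk', (hπ n).monotone hkx⟩
      _ ⟨isCompactElement_projection (hκ n) (hπ n).monotone (hid n) hl hl', (hπ n).monotone hlx⟩
    exact ⟨κ n j, ⟨isCompactElement_embedding (hκ n).monotone (hπ n) (hid n) (hle n) hj,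
      ((hκ n).monotone hjx).trans (hle n x)⟩, hk'.ge.trans ((hκ n).monotone hkj),
      hl'.ge.trans ((hκ n).monotone hlj)⟩
  isLUB_compact x := by
    refine ⟨fun k hk => hk.2, fun b hb => (hlub x).2 ?_⟩
    rintro _ ⟨n, rfl⟩
    have hne : {k : D n | IsCompactElement k ∧ k ≤ π n x}.Nonempty :=
      ⟨⊥, ScottDom.isCompactElement_bot, bot_le⟩
    refine (hκ n hne
      (IsScottDomain.directedOn_compact (π n x)) (IsScottDomain.isLUB_compact (π n x))).2 ?_
    rintro _ ⟨j, ⟨hj, hjx⟩, rfl⟩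
    exact hb ⟨isCompactElement_embedding (hκ n).monotone (hπ n) (hid n) (hle n) hj,
      ((hκ n).monotone hjx).trans (hle n x)⟩
  countable_compact := by
    -- Every compact element is the image of a compact element of some stage.
    refine (Set.countable_iUnion fun n =>
      (IsScottDomain.countable_compact (D := D n)).image (κ n)).mono fun k hk => ?_
    obtain ⟨N, hN⟩ := exists_fixed_of_isCompactElement hle hmono hlub hk
    exact Set.mem_iUnion.2 ⟨N, π N k,
      isCompactElement_projection (hκ N) (hπ N).monotone (hid N) hk (hN N le_rfl), hN N le_rfl⟩

end Approximation

/-! ## Limits of chains of projections -/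

namespace ScottDom

theorem Hom.monotone {D E : ScottDom.{u}} (f : D ⟶ E) : Monotone f.toFun :=
  f.continuous.monotone

/-- The meet is the supremum of the common lower bounds, a set bounded by `x`. -/
theorem exists_isGLB_pair (D : ScottDom.{u}) (x y : D) : ∃ z, IsGLB {x, y} z := by
  obtain ⟨z, hz⟩ := IsScottDomain.boundedComplete (lowerBounds {x, y})
    ⟨x, fun w hw => hw (by simp)⟩
  exact ⟨z, isLUB_lowerBounds.1 hz⟩

variable (J : EmbChain ScottDom.{u})

/-- The compatible sequences of a chain of embeddings. -/
def LimitSeq : Type u :=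
  {x : ∀ n, J.functor.obj n // ∀ {m n : ℕ} (h : m ≤ n), (J.prj h).toFun (x n) = x m}

namespace LimitSeq

instance : PartialOrder (LimitSeq J) :=
  inferInstanceAs (PartialOrder
    {x : ∀ n, J.functor.obj n // ∀ {m n : ℕ} (h : m ≤ n), (J.prj h).toFun (x n) = x m})

instance : OrderBot (LimitSeq J) where
  bot := ⟨fun _ => ⊥, fun h => (J.prj h).strict⟩
  bot_le _ := fun _ => bot_le

variable {J}

theorem isLUB_of_forall {s : Set (LimitSeq J)} {a : LimitSeq J}
    (h : ∀ n, IsLUB ((fun x : LimitSeq J => x.1 n) '' s) (a.1 n)) : IsLUB s a :=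
  ⟨fun x hx n => (h n).1 ⟨x, hx, rfl⟩, fun b hb n => (h n).2 (by
    rintro _ ⟨x, hx, rfl⟩
    exact hb hx n)⟩

theorem directedOn_image {s : Set (LimitSeq J)} (hd : DirectedOn (· ≤ ·) s) (n : ℕ) :
    DirectedOn (· ≤ ·) ((fun x : LimitSeq J => x.1 n) '' s) :=
  hd.mono_comp fun {_ _} h => h n

/-- The coordinatewise suprema are again compatible because the projections are continuous. -/
theorem exists_forall_isLUB (s : Set (LimitSeq J)) (hs : s.Nonempty)
    (hd : DirectedOn (· ≤ ·) s) :
    ∃ a : LimitSeq J, ∀ n, IsLUB ((fun x : LimitSeq J => x.1 n) '' s) (a.1 n) := by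
  choose a ha using fun n =>
    IsScottDomain.directedComplete _ (hs.image fun x : LimitSeq J => x.1 n) (directedOn_image hd n)
  refine ⟨⟨a, fun {m n} h => ?_⟩, ha⟩
  refine ((J.prj h).continuous (hs.image _) (directedOn_image hd n) (ha n)).unique ?_
  rw [Set.image_image]
  have hx : (fun x : LimitSeq J => (J.prj h).toFun (x.1 n)) = fun x => x.1 m :=
    funext fun x => x.2 h
  rw [hx]
  exact ha m

theorem scottContinuous_proj (n : ℕ) : ScottContinuous fun x : LimitSeq J => x.1 n := by
  intro s hs hd a ha
  obtain ⟨b, hb⟩ := exists_forall_isLUB s hs hd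
  rw [ha.unique (isLUB_of_forall hb)]
  exact hb n

variable (J) in
/-- The legs of the colimit, as functions. -/
noncomputable def leg (n : ℕ) (x : J.functor.obj n) : LimitSeq J :=
  ⟨fun m => (J.transit n m).toFun x, fun h =>
    congrArg (fun f => f.toFun x) (J.transit_prj n h)⟩

theorem scottContinuous_leg (n : ℕ) : ScottContinuous (leg J n) := by
  intro s hs hd a ha
  refine isLUB_of_forall fun m => ?_
  rw [Set.image_image]
  exact (J.transit n m).continuous hs hd ha

theorem leg_proj (n : ℕ) (x : J.functor.obj n) : (leg J n x).1 n = x := by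
  change (J.transit n n).toFun x = x
  rw [J.transit_of_le le_rfl, J.prj_self]
  rfl

theorem leg_emb {m n : ℕ} (h : m ≤ n) (x : J.functor.obj m) :
    leg J n ((J.emb h).toFun x) = leg J m x :=
  Subtype.ext (funext fun k => congrArg (fun f => f.toFun x) (J.emb_transit h k))

theorem proj_leg_le (n : ℕ) (x : LimitSeq J) : leg J n (x.1 n) ≤ x := by
  intro m
  change (J.transit n m).toFun (x.1 n) ≤ x.1 m
  -- Both coordinates are projections of the coordinate at `max n m`.
  rw [← x.2 (le_max_left n m), ← x.2 (le_max_right n m)]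
  exact J.prj_transit_le (le_max_left n m) (le_max_right n m) (x.1 (max n m))

theorem monotone_proj_leg (x : LimitSeq J) : Monotone fun n => leg J n (x.1 n) := by
  intro m n h
  change leg J m (x.1 m) ≤ leg J n (x.1 n)
  rw [← leg_emb h, ← x.2 h]
  exact (scottContinuous_leg n).monotone ((J.isEPPair h).comp_le (x.1 n))

/-- The `m`-th approximation already has the right `m`-th coordinate, so an upper bound dominates
`x` coordinate by coordinate. -/
theorem isLUB_proj_leg (x : LimitSeq J) : IsLUB (Set.range fun n => leg J n (x.1 n)) x := by
  refine ⟨?_, fun b hb m => ?_⟩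
  · rintro _ ⟨n, rfl⟩
    exact proj_leg_le n x
  · calc x.1 m = (leg J m (x.1 m)).1 m := (leg_proj m _).symm
      _ ≤ b.1 m := hb ⟨m, rfl⟩ m

instance : IsScottDomain (LimitSeq J) :=
  isScottDomain_of_approx (D := fun n => J.functor.obj n) (κ := leg J) (π := fun n x => x.1 n)
    (fun s hs hd => (exists_forall_isLUB s hs hd).imp fun _ h => isLUB_of_forall h)
    scottContinuous_leg scottContinuous_proj leg_proj proj_leg_le monotone_proj_leg isLUB_proj_leg

theorem isGLB_of_forall {x y z : LimitSeq J} (h : ∀ n, IsGLB {x.1 n, y.1 n} (z.1 n)) :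
    IsGLB {x, y} z := by
  refine ⟨?_, fun w hw n => (h n).2 ?_⟩
  · rintro _ (rfl | rfl)
    · exact fun n => (h n).1 (by simp)
    · exact fun n => (h n).1 (by simp)
  · rintro _ (rfl | rfl)
    · exact hw (by simp : x ∈ ({x, y} : Set _)) n
    · exact hw (by simp : y ∈ ({x, y} : Set _)) n

/-- Coordinatewise meets form a compatible sequence because the projections preserve meets; by
uniqueness that sequence is `z`. -/
theorem isGLB_proj {x y z : LimitSeq J} (h : IsGLB {x, y} z) (n : ℕ) :
    IsGLB {x.1 n, y.1 n} (z.1 n) := by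
  choose w hw using fun n => exists_isGLB_pair (J.functor.obj n) (x.1 n) (y.1 n)
  have hz : z = ⟨w, fun {m n} hmn => by
      refine ((J.prj hmn).map_meet _ _ _ (hw n)).unique ?_
      rw [x.2, y.2]
      exact hw m⟩ := h.unique (isGLB_of_forall hw)
  rw [hz]
  exact hw n

end LimitSeq

theorem nonempty_oColimit : Nonempty (OColimit J) := by
  let κ (n : ℕ) : J.functor.obj n ⟶ (⟨LimitSeq J⟩ : ScottDom.{u}) :=
    { toFun := LimitSeq.leg J n
      strict := Subtype.ext (funext fun m => (J.transit n m).strict)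
      continuous := LimitSeq.scottContinuous_leg n
      map_meet := fun x y z h =>
        LimitSeq.isGLB_of_forall fun m => (J.transit n m).map_meet x y z h }
  let π (n : ℕ) : (⟨LimitSeq J⟩ : ScottDom.{u}) ⟶ J.functor.obj n :=
    { toFun := fun x => x.1 n
      strict := rfl
      continuous := LimitSeq.scottContinuous_proj n
      map_meet := fun _ _ _ h => LimitSeq.isGLB_proj h n }
  refine OColimit.nonempty_of_isEPPair _ κ π
    (fun n => ⟨hom_ext (LimitSeq.leg_proj n), LimitSeq.proj_leg_le n⟩)
    (fun h => hom_ext (LimitSeq.leg_emb h)) ⟨?_, fun b hb x => ?_⟩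
  · rintro _ ⟨n, rfl⟩
    exact LimitSeq.proj_leg_le n
  · refine (LimitSeq.isLUB_proj_leg x).2 ?_
    rintro _ ⟨n, rfl⟩
    exact hb ⟨n, rfl⟩ x

/-! ### The initial object, and pairing of embeddings -/

instance : IsScottDomain PUnit.{u + 1} where
  directedComplete _ _ _ := ⟨⟨⟩, fun _ _ => le_rfl, fun _ _ => le_rfl⟩
  boundedComplete _ _ := ⟨⟨⟩, fun _ _ => le_rfl, fun _ _ => le_rfl⟩
  directedOn_compact _ := fun x hx _ _ => ⟨x, hx, le_rfl, le_rfl⟩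
  isLUB_compact _ := ⟨fun _ _ => le_rfl, fun _ _ => le_rfl⟩
  countable_compact := Set.to_countable _

theorem hasInitial : Limits.HasInitial ScottDom.{u} :=
  (Limits.IsInitial.ofUniqueHom (X := (⟨PUnit.{u + 1}⟩ : ScottDom.{u})) (fun _ => 0)
    fun _ f => hom_ext fun _ => f.strict).hasInitial

theorem supportsCanonicalFixedPoints : SupportsCanonicalFixedPoints ScottDom.{u} :=
  ⟨hasInitial, inferInstance, nonempty_oColimit⟩

/-- The pairing of two embeddings is an embedding; its projection is
`(x, y) ↦ f^p x ⊓ g^p y`. -/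
theorem isEmbedding_lift {C D E : ScottDom.{u}} {f : C ⟶ D} {g : C ⟶ E} (hf : IsEmbedding f)
    (hg : IsEmbedding g) : IsEmbedding (lift f g) := by
  obtain ⟨p, hp⟩ := hf
  obtain ⟨q, hq⟩ := hg
  choose m hm using fun x : prod C C => exists_isGLB_pair C x.1 x.2
  have hm1 : ∀ x, m x ≤ x.1 := fun x => (hm x).1 (by simp)
  have hm2 : ∀ x, m x ≤ x.2 := fun x => (hm x).1 (by simp)
  have hm3 : ∀ x w, w ≤ x.1 → w ≤ x.2 → w ≤ m x := fun x w h1 h2 => (hm x).2 (by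
    rintro _ (rfl | rfl)
    · exact h1
    · exact h2)
  have mono : Monotone m := fun x y hxy =>
    hm3 y _ ((hm1 x).trans hxy.1) ((hm2 x).trans hxy.2)
  let μ : prod C C ⟶ C :=
    { toFun := m
      strict := le_bot_iff.1 (hm1 ⊥)
      continuous := by
        intro s hs hd a ha
        refine ⟨mono.mem_upperBounds_image ha.1, fun b hb => ?_⟩
        -- Continuity of the meet uses algebraicity: a compact `k` below both suprema lies below
        -- both coordinates of one `z` in `s`.
        refine (IsScottDomain.isLUB_compact (m a)).2 ?_
        rintro k ⟨hk, hka⟩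
        obtain ⟨h1, h2⟩ := isLUB_prod.1 ha
        obtain ⟨_, ⟨x, hx, rfl⟩, hkx⟩ := hk _ _ (hs.image _) hd.fst h1 (hka.trans (hm1 a))
        obtain ⟨_, ⟨y, hy, rfl⟩, hky⟩ := hk _ _ (hs.image _) hd.snd h2 (hka.trans (hm2 a))
        obtain ⟨z, hz, hxz, hyz⟩ := hd x hx y hy
        exact (hm3 z k (hkx.trans hxz.1) (hky.trans hyz.2)).trans (hb ⟨z, hz, rfl⟩)
      map_meet := by
        intro x y z h
        obtain ⟨h1, h2⟩ := isGLB_pair_prod.1 h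
        refine ⟨?_, fun w hw => ?_⟩
        · rintro _ (rfl | rfl)
          · exact mono (h.1 (by simp))
          · exact mono (h.1 (by simp))
        · have hx : w ≤ m x := hw (by simp)
          have hy : w ≤ m y := hw (by simp)
          refine hm3 z w (h1.2 ?_) (h2.2 ?_)
          · rintro _ (rfl | rfl)
            · exact hx.trans (hm1 x)
            · exact hy.trans (hm1 y)
          · rintro _ (rfl | rfl)
            · exact hx.trans (hm2 x)
            · exact hy.trans (hm2 y) }
  refine ⟨lift (fst D E ≫ p) (snd D E ≫ q) ≫ μ, hom_ext fun x => ?_, fun x => ?_⟩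
  · have h1 : p.toFun (f.toFun x) = x := congrArg (fun h => h.toFun x) hp.comp_eq
    have h2 : q.toFun (g.toFun x) = x := congrArg (fun h => h.toFun x) hq.comp_eq
    change m (p.toFun (f.toFun x), q.toFun (g.toFun x)) = x
    rw [h1, h2]
    exact (hm1 _).antisymm (hm3 (x, x) x le_rfl le_rfl)
  · exact ⟨(f.monotone (hm1 (p.toFun x.1, q.toFun x.2))).trans (hp.comp_le x.1),
      (g.monotone (hm2 (p.toFun x.1, q.toFun x.2))).trans (hq.comp_le x.2)⟩

end ScottDom

/-! ## 2-cells between locally continuous functors -/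

/-- A 2-cell between locally continuous functors, together with its source and target. -/
structure Cell (C : Type u₁) [Category.{v₁} C] [OCategory C]
    (D : Type u₂) [Category.{v₂} D] [OCategory D] where
  src : LCFunctor C D
  tgt : LCFunctor C D
  trans : src.toFunctor ⟶ tgt.toFunctor

theorem LCFunctor.ext_toFunctor {C : Type u₁} [Category.{v₁} C] [OCategory C]
    {D : Type u₂} [Category.{v₂} D] [OCategory D] {F G : LCFunctor C D}
    (h : F.toFunctor = G.toFunctor) : F = G := by
  cases F; cases G; cases h; rfl

namespace Cell

/-! ### The calculus of 2-cells: horizontal composition, tuples, products -/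

section Basic

variable {C : Type u₁} [Category.{v₁} C] [OCategory C]
  {D : Type u₂} [Category.{v₂} D] [OCategory D]
  {E : Type u₃} [Category.{v₃} E] [OCategory E]

/-- Equality of 2-cells whose sources and targets agree on objects. -/
theorem ext_app {α β : Cell C D} (hs : α.src = β.src) (ht : α.tgt = β.tgt)
    (h : ∀ X, HEq (α.trans.app X) (β.trans.app X)) : α = β := by
  obtain ⟨F, G, η⟩ := α
  obtain ⟨F', G', θ⟩ := β
  obtain rfl : F = F' := hs
  obtain rfl : G = G' := ht
  obtain rfl : η = θ := NatTrans.ext (funext fun X => eq_of_heq (h X))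
  rfl

theorem trans_eq_of_mk_eq {F G : LCFunctor C D} {η θ : F.toFunctor ⟶ G.toFunctor}
    (h : (⟨F, G, η⟩ : Cell C D) = ⟨F, G, θ⟩) : η = θ := by
  injection h

/-- The identity 2-cell. -/
def id (F : LCFunctor C D) : Cell C D := ⟨F, F, 𝟙 _⟩

/-- Horizontal composition, in diagrammatic order. -/
def comp (α : Cell C D) (β : Cell D E) : Cell C E :=
  ⟨α.src.comp β.src, α.tgt.comp β.tgt, α.trans ◫ β.trans⟩

theorem comp_assoc {E' : Type u} [Category.{v} E'] [OCategory E'] (α : Cell C D) (β : Cell D E)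
    (γ : Cell E E') : (α.comp β).comp γ = α.comp (β.comp γ) := by
  refine ext_app rfl rfl fun X => heq_of_eq ?_
  change γ.trans.app _ ≫ γ.tgt.map (β.trans.app _ ≫ β.tgt.map (α.trans.app X)) =
    (γ.trans.app _ ≫ γ.tgt.map (β.trans.app _)) ≫ γ.tgt.map (β.tgt.map (α.trans.app X))
  rw [Functor.map_comp, Category.assoc]

theorem id_comp_id (F : LCFunctor C D) (G : LCFunctor D E) :
    (id F).comp (id G) = id (F.comp G) := by
  refine ext_app rfl rfl fun X => heq_of_eq ?_
  change 𝟙 _ ≫ G.map (𝟙 (F.obj X)) = 𝟙 _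
  rw [CategoryTheory.Functor.map_id, Category.comp_id]

/-- The tuple of a family of 2-cells. -/
def tuple {n : ℕ} (α : Fin n → Cell C D) : Cell C (Fin n → D) :=
  ⟨LCFunctor.tuple fun i => (α i).src, LCFunctor.tuple fun i => (α i).tgt,
    tupleTrans fun i => (α i).trans⟩

theorem tuple_comp_eval {n : ℕ} (α : Fin n → Cell C D) (i : Fin n) :
    (tuple α).comp (id (LCFunctor.eval i)) = α i := by
  refine ext_app rfl rfl fun X => heq_of_eq ?_
  exact Category.id_comp ((α i).trans.app X)

/-- The coordinate projections are jointly monic on 2-cells. Sources and targets must be identified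
first, since only then do the components have the same type. -/
theorem comp_eval_congr {n : ℕ} {α β : Cell C (Fin n → D)}
    (h : ∀ i, α.comp (id (LCFunctor.eval i)) = β.comp (id (LCFunctor.eval i))) : α = β := by
  obtain ⟨F, G, η⟩ := α
  obtain ⟨F', G', θ⟩ := β
  obtain rfl : F = F' := LCFunctor.ext_toFunctor <| Functor.pi_ext _ _ fun i =>
    congrArg (fun γ : Cell C D => γ.src.toFunctor) (h i)
  obtain rfl : G = G' := LCFunctor.ext_toFunctor <| Functor.pi_ext _ _ fun i =>
    congrArg (fun γ : Cell C D => γ.tgt.toFunctor) (h i)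
  refine ext_app rfl rfl fun X => heq_of_eq (funext fun i => ?_)
  have hX := congrArg (fun τ => τ.app X) (trans_eq_of_mk_eq (h i))
  change 𝟙 _ ≫ η.app X i = 𝟙 _ ≫ θ.app X i at hX
  simpa only [Category.id_comp] using hX

/-- The 2-cell `α × E`. -/
def prodRight (α : Cell C D) (E : Type u₃) [Category.{v₃} E] [OCategory E] :
    Cell (C × E) (D × E) where
  src :=
    { toFunctor := α.src.toFunctor.prod (𝟭 E)
      scottContinuous_map := fun X Y =>
        ScottContinuous.prodMk (α := (X.1 ⟶ Y.1) × (X.2 ⟶ Y.2))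
          (ScottContinuous.fst.comp (α.src.scottContinuous_map X.1 Y.1)) ScottContinuous.snd }
  tgt :=
    { toFunctor := α.tgt.toFunctor.prod (𝟭 E)
      scottContinuous_map := fun X Y =>
        ScottContinuous.prodMk (α := (X.1 ⟶ Y.1) × (X.2 ⟶ Y.2))
          (ScottContinuous.fst.comp (α.tgt.scottContinuous_map X.1 Y.1)) ScottContinuous.snd }
  trans := NatTrans.prod α.trans (𝟙 (𝟭 E))

theorem prodRight_comp_fst (α : Cell C D) :
    (α.prodRight E).comp (id (LCFunctor.fst D E)) = (id (LCFunctor.fst C E)).comp α := by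
  refine ext_app rfl rfl fun X => heq_of_eq ?_
  change 𝟙 _ ≫ α.trans.app X.1 = α.trans.app X.1 ≫ α.tgt.map (𝟙 X.1)
  rw [CategoryTheory.Functor.map_id, Category.comp_id, Category.id_comp]

theorem prodRight_comp_snd (α : Cell C D) :
    (α.prodRight E).comp (id (LCFunctor.snd D E)) = id (LCFunctor.snd C E) := by
  refine ext_app rfl rfl fun X => heq_of_eq ?_
  exact Category.comp_id (𝟙 X.2)

end Basic

/-! ### Context extension and weakening -/

section Extend

variable {D : Type u} [Category.{v} D] [OCategory D]

theorem extend_comp_eval_zero (n : ℕ) :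
    (id (LCFunctor.extend D n)).comp (id (LCFunctor.eval 0)) = id (LCFunctor.snd _ _) :=
  id_comp_id _ _

theorem extend_comp_eval_succ (n : ℕ) (i : Fin n) :
    (id (LCFunctor.extend D n)).comp (id (LCFunctor.eval i.succ)) =
      (id (LCFunctor.fst _ _)).comp (id (LCFunctor.eval i)) := by
  rw [id_comp_id, id_comp_id]; rfl

/-- Weakening by the variable with index `0`. -/
def weaken (D : Type u) [Category.{v} D] [OCategory D] (n : ℕ) :
    Cell (Fin (n + 1) → D) (Fin n → D) :=
  tuple fun i => id (LCFunctor.eval i.succ)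

theorem extend_comp_weaken (n : ℕ) :
    (id (LCFunctor.extend D n)).comp (weaken D n) = id (LCFunctor.fst _ _) :=
  comp_eval_congr fun i => by
    rw [comp_assoc, weaken, tuple_comp_eval, extend_comp_eval_succ]

/-- Extending a tuple of 2-cells by a fresh variable. -/
theorem extend_comp_tuple_cases {n m : ℕ} (β : Fin n → Cell (Fin m → D) D)
    (γ : Fin (n + 1) → Cell (Fin (m + 1) → D) D) (h0 : γ 0 = id (LCFunctor.eval 0))
    (hs : ∀ i, γ (Fin.succ i) = (weaken D m).comp (β i)) :
    (id (LCFunctor.extend D m)).comp (tuple γ) =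
      ((tuple β).prodRight D).comp (id (LCFunctor.extend D n)) :=
  comp_eval_congr fun i => by
    rw [comp_assoc, tuple_comp_eval, comp_assoc]
    refine Fin.cases ?_ (fun i => ?_) i
    · rw [h0, extend_comp_eval_zero, extend_comp_eval_zero, prodRight_comp_snd]
    · rw [hs, extend_comp_eval_succ, ← comp_assoc, extend_comp_weaken, ← comp_assoc,
        prodRight_comp_fst, comp_assoc, tuple_comp_eval]

end Extend

/-! ### Strict naturality of the dagger -/

section Dagger

variable {C : Type u₁} [Category.{v₁} C] [OCategory C]
  {D : Type u₂} [Category.{v₂} D] [OCategory D]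
  {E : Type u} [Category.{v} E] [OCategory E]

theorem partialApp_comp_prod {F : LCFunctor C D} {F' : LCFunctor (C × E) (D × E)}
    (hF : F'.toFunctor = F.toFunctor.prod (𝟭 E)) (G : LCFunctor (D × E) E) (X : C) :
    (F'.comp G).partialApp X = G.partialApp (F.obj X) := by
  obtain ⟨F', _⟩ := F'
  obtain rfl : F' = _ := hF
  refine LCFunctor.ext_toFunctor (CategoryTheory.Functor.hext (fun _ => rfl) fun Y Z g => heq_of_eq ?_)
  -- The two sides differ only in the first argument of `G`, which is F(id) on one side and id on
  -- the other.
  exact congrArg (fun f => G.map (X := (F.obj X, Y)) (Y := (F.obj X, Z)) (f, g)) (F.map_id X)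

variable [Limits.HasZeroMorphisms E] [HasStrictMorphisms E] (c : FixChoice E)

/-- The dagger of a 2-cell. -/
noncomputable def dagger (α : Cell (D × E) E) : Cell D E :=
  ⟨SessionSem.dagger c α.src, SessionSem.dagger c α.tgt, daggerMap c α.trans⟩

theorem fixMap_heq {F F' G G' : LCFunctor E E} (hF : F = F') (hG : G = G')
    {η : F.toFunctor ⟶ G.toFunctor} {θ : F'.toFunctor ⟶ G'.toFunctor}
    (h : ∀ X, HEq (η.app X) (θ.app X)) : HEq (fixMap c η) (fixMap c θ) := by
  subst hF hG
  obtain rfl : η = θ := NatTrans.ext (funext fun X => eq_of_heq (h X))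
  rfl

/-- The partial applications are equal functors, and the chosen O-colimit depends only on the
functor, so the fixed points are equal and not merely isomorphic. -/
theorem dagger_comp_prod {F : LCFunctor C D} {F' : LCFunctor (C × E) (D × E)}
    (hF : F'.toFunctor = F.toFunctor.prod (𝟭 E)) (G : LCFunctor (D × E) E) :
    SessionSem.dagger c (F'.comp G) = F.comp (SessionSem.dagger c G) := by
  refine LCFunctor.ext_toFunctor (CategoryTheory.Functor.hext (fun X => ?_) fun X Y f => ?_)
  · exact congrArg (fixObj c) (partialApp_comp_prod hF G X)
  · refine fixMap_heq c (partialApp_comp_prod hF G X) (partialApp_comp_prod hF G Y) fun Z => ?_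
    obtain ⟨F', _⟩ := F'
    obtain rfl : F' = _ := hF
    rfl

/-- Strict naturality of the dagger in the parameter. -/
theorem dagger_prodRight_comp (α : Cell C D) (β : Cell (D × E) E) :
    dagger c ((α.prodRight E).comp β) = α.comp (dagger c β) := by
  refine ext_app (dagger_comp_prod c rfl β.src) (dagger_comp_prod c rfl β.tgt) fun X => ?_
  -- The horizontal composite is a composite of two FIX maps, one from `β.trans` and one from the
  -- action of the target dagger on `α`; `fixMap_comp` merges them.
  have h : (α.comp (dagger c β)).trans.app X =
      fixMap c (partialTrans β.trans (α.src.obj X) ≫ partialMap β.tgt (α.trans.app X)) :=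
    (fixMap_comp c _ _).symm
  rw [h]
  exact fixMap_heq c (partialApp_comp_prod (F := α.src) rfl β.src X)
    (partialApp_comp_prod (F := α.tgt) rfl β.tgt X) fun Z => heq_of_eq rfl

end Dagger

/-! ### Renaming and substitution for one polarity -/

section Types

variable (c : FixChoice ScottDom.{u})

/-- The dagger of a 2-cell in the context of `n + 1` variables. -/
noncomputable def daggerCtx {n : ℕ} (α : Cell (Ctx.{u} (n + 1)) ScottDom.{u}) :
    Cell (Ctx.{u} n) ScottDom.{u} :=
  dagger c ((id (LCFunctor.extend ScottDom.{u} n)).comp α)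

/-- Horizontal composition with an identity 2-cell is whiskering, up to an extra factor `α.tgt.map
(𝟙 _)`. -/
theorem daggerCtx_eq {n : ℕ} (α : Cell (Ctx.{u} (n + 1)) ScottDom.{u}) :
    daggerCtx c α = ⟨SessionSem.daggerCtx c α.src, SessionSem.daggerCtx c α.tgt,
      daggerCtxMap c α.trans⟩ := by
  have h : (id (LCFunctor.extend ScottDom.{u} n)).comp α =
      ⟨(LCFunctor.extend ScottDom.{u} n).comp α.src, (LCFunctor.extend ScottDom.{u} n).comp α.tgt,
        Functor.whiskerLeft (LCFunctor.extend ScottDom.{u} n).toFunctor α.trans⟩ := by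
    refine ext_app rfl rfl fun X => heq_of_eq ?_
    refine (congrArg (α.trans.app ((LCFunctor.extend ScottDom.{u} n).obj X) ≫ ·)
      (α.tgt.map_id _)).trans (Category.comp_id _)
  rw [daggerCtx, h]
  rfl

/-- The binder case shared by renaming and substitution: `γ` is `β` lifted under the binder, fixing
the new variable and weakening the rest. -/
theorem daggerCtx_tuple_comp {n m : ℕ} (β : Fin n → Cell (Ctx.{u} m) ScottDom.{u})
    (γ : Fin (n + 1) → Cell (Ctx.{u} (m + 1)) ScottDom.{u}) (h0 : γ 0 = id (LCFunctor.eval 0))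
    (hs : ∀ i, γ (Fin.succ i) = (weaken ScottDom.{u} m).comp (β i))
    (α : Cell (Ctx.{u} (n + 1)) ScottDom.{u}) :
    daggerCtx c ((tuple γ).comp α) = (tuple β).comp (daggerCtx c α) := by
  rw [daggerCtx, ← comp_assoc, extend_comp_tuple_cases β γ h0 hs, comp_assoc,
    dagger_prodRight_comp, daggerCtx]

variable {c} {T : ∀ {n : ℕ}, SessionType n → Cell (Ctx.{u} n) ScottDom.{u}}

/-- Supplies the weakening of the `B i` needed under a binder in `interp_subst`. `T` is abstract so
that one proof serves both polarities. -/
theorem interp_rename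
    (hvar : ∀ {n : ℕ} (i : Fin n), T (.var i) = id (LCFunctor.eval i))
    (hmu : ∀ {n : ℕ} (A : SessionType (n + 1)), T (.mu A) = daggerCtx c (T A))
    {n m : ℕ} (A : SessionType n) (r : Fin n → Fin m) :
    T (A.rename r) = (tuple fun i => id (LCFunctor.eval (r i))).comp (T A) := by
  induction A generalizing m with
  | var i => rw [SessionType.rename, hvar, hvar, tuple_comp_eval]
  | mu A ih =>
    rw [SessionType.rename, hmu, hmu, ih]
    refine daggerCtx_tuple_comp c _ _ rfl (fun i => ?_) _
    rw [weaken, tuple_comp_eval]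
    rfl

theorem interp_subst
    (hvar : ∀ {n : ℕ} (i : Fin n), T (.var i) = id (LCFunctor.eval i))
    (hmu : ∀ {n : ℕ} (A : SessionType (n + 1)), T (.mu A) = daggerCtx c (T A))
    {n m : ℕ} (A : SessionType n) (B : Fin n → SessionType m) :
    T (A.subst B) = (tuple fun i => T (B i)).comp (T A) := by
  induction A generalizing m with
  | var i => rw [SessionType.subst, hvar, tuple_comp_eval]
  | mu A ih =>
    rw [SessionType.subst, hmu, hmu, ih]
    exact daggerCtx_tuple_comp c _ _ (hvar 0) (fun i => interp_rename hvar hmu (B i) Fin.succ) _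

end Types

end Cell

/-! ## Embeddings and canonical fixed points -/

section FixEmbedding

variable {E : Type u} [Category.{v} E] [OCategory E]

/-- Joint continuity of composition, applied along the diagonal of two ascending sequences. -/
theorem isLUB_comp {X Y Z : E} {f : ℕ → (X ⟶ Y)} {g : ℕ → (Y ⟶ Z)} (hf : Monotone f)
    (hg : Monotone g) {a : X ⟶ Y} {b : Y ⟶ Z} (ha : IsLUB (Set.range f) a)
    (hb : IsLUB (Set.range g) b) : IsLUB (Set.range fun n => f n ≫ g n) (a ≫ b) := by
  have hl : IsLUB (Set.range fun n => (f n, g n)) (a, b) := by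
    refine isLUB_prod.2 ⟨?_, ?_⟩
    · rw [← Set.range_comp]; exact ha
    · rw [← Set.range_comp]; exact hb
  have h := OCategory.comp_continuous _ _ _ (Set.range_nonempty _)
    (hf.prodMk hg).directed_le.directedOn_range hl
  rw [← Set.range_comp] at h
  exact h

theorem isEmbedding_iterTrans {F G : LCFunctor E E} {η : F.toFunctor ⟶ G.toFunctor}
    (h : ∀ X, IsEmbedding (η.app X)) (X : E) (n : ℕ) : IsEmbedding (iterTrans η X n) := by
  induction n with
  | zero => exact ⟨_, IsEPPair.id X⟩
  | succ n ih => exact IsEmbedding.comp ⟨_, F.map_isEPPair ih.isEPPair⟩ (h _)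

variable [Limits.HasZeroMorphisms E] [HasStrictMorphisms E] (c : FixChoice E)

/-- The approximants `p n` reverse the three factors of `fixApprox`, and their supremum is the
projection. Both laws are checked stage by stage and pass to the supremum. -/
theorem isEmbedding_fixMap {F G : LCFunctor E E} {η : F.toFunctor ⟶ G.toFunctor}
    (h : ∀ X, IsEmbedding (η.app X)) : IsEmbedding (fixMap c η) := by
  have ht := isEmbedding_iterTrans h c.bot
  let p (n : ℕ) : fixObj c G ⟶ fixObj c F := fixProj c G n ≫ (ht n).proj ≫ fixLeg c F n
  have hp : Monotone p := by
    refine monotone_nat_of_le_succ fun n => ?_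
    have hF := (isEmbedding_iterLink c F n).isEPPair
    have hG := (isEmbedding_iterLink c G n).isEPPair
    -- The projection form of the square `iterLink_iterTrans`, by uniqueness of projections.
    have hcomm : (ht (n + 1)).proj ≫ (isEmbedding_iterLink c F n).proj =
        (isEmbedding_iterLink c G n).proj ≫ (ht n).proj := by
      have h1 := hF.comp (ht (n + 1)).isEPPair
      rw [iterLink_iterTrans] at h1
      exact h1.unique ((ht n).isEPPair.comp hG)
    have hproj : fixProj c G n = fixProj c G (n + 1) ≫ (isEmbedding_iterLink c G n).proj := by
      have h1 := hG.comp (isEPPair_fix c G (n + 1))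
      rw [iterLink_fixLeg] at h1
      exact (isEPPair_fix c G n).unique h1
    calc p n = fixProj c G (n + 1) ≫ (ht (n + 1)).proj ≫
          ((isEmbedding_iterLink c F n).proj ≫
            iterLink F.toFunctor (c.isInitial.to (F.obj c.bot)) n) ≫ fixLeg c F (n + 1) := by
          simp only [p]
          rw [hproj, ← iterLink_fixLeg c F, Category.assoc,
            ← Category.assoc (isEmbedding_iterLink c G n).proj, ← hcomm]
          simp only [Category.assoc]
      _ ≤ fixProj c G (n + 1) ≫ (ht (n + 1)).proj ≫ 𝟙 _ ≫ fixLeg c F (n + 1) :=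
          comp_mono le_rfl (comp_mono le_rfl (comp_mono hF.comp_le le_rfl))
      _ = p (n + 1) := by rw [Category.id_comp]
  obtain ⟨q, hq⟩ := OCategory.exists_isLUB _ (Set.range_nonempty p)
    hp.directed_le.directedOn_range
  refine ⟨q, ?_, ?_⟩
  · refine (isLUB_comp (monotone_fixApprox c η) hp (isLUB_fixMap c η) hq).unique ?_
    -- The middle factors cancel, leaving the approximations of the identity supplied by the
    -- O-colimit of `F`.
    have hn : (fun n => fixApprox c η n ≫ p n) = fun n => fixProj c F n ≫ fixLeg c F n := by
      funext n
      simp only [fixApprox, p, Category.assoc]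
      rw [← Category.assoc (fixLeg c G n), (isEPPair_fix c G n).comp_eq, Category.id_comp,
        ← Category.assoc (iterTrans η c.bot n), (ht n).isEPPair.comp_eq, Category.id_comp]
    rw [hn]
    exact (c.colim (fixChain c F)).isLUB
  · refine (isLUB_comp hp (monotone_fixApprox c η) hq (isLUB_fixMap c η)).2 ?_
    rintro _ ⟨n, rfl⟩
    simp only [fixApprox, p, Category.assoc]
    rw [← Category.assoc (fixLeg c F n), (isEPPair_fix c F n).comp_eq, Category.id_comp]
    calc fixProj c G n ≫ (ht n).proj ≫ iterTrans η c.bot n ≫ fixLeg c G n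
        = fixProj c G n ≫ ((ht n).proj ≫ iterTrans η c.bot n) ≫ fixLeg c G n := by
          simp only [Category.assoc]
      _ ≤ fixProj c G n ≫ 𝟙 _ ≫ fixLeg c G n :=
          comp_mono le_rfl (comp_mono (ht n).isEPPair.comp_le le_rfl)
      _ ≤ 𝟙 _ := by rw [Category.id_comp]; exact (isEPPair_fix c G n).comp_le

end FixEmbedding

/-! ## The two polarities of the interpretation -/

section Polarities

variable (c : FixChoice ScottDom.{u})

theorem isEmbedding_daggerCtxMap {n : ℕ} {F G : LCFunctor (Ctx.{u} (n + 1)) ScottDom.{u}}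
    {η : F.toFunctor ⟶ G.toFunctor} (h : ∀ X, IsEmbedding (η.app X)) (X : Ctx.{u} n) :
    IsEmbedding ((daggerCtxMap c η).app X) :=
  isEmbedding_fixMap c fun _ => h _

/-- The induction runs on the components because the ρ case takes the dagger of each component, not
of the paired 2-cell. -/
theorem isEmbedding_cellNeg_and_cellPos {n : ℕ} (A : SessionType n) :
    (∀ X, IsEmbedding ((interp c A).cellNeg.app X)) ∧
      ∀ X, IsEmbedding ((interp c A).cellPos.app X) := by
  induction A with
  | var i => exact ⟨fun X => ⟨_, IsEPPair.id _⟩, fun X => ⟨_, IsEPPair.id _⟩⟩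
  | mu A ih => exact ⟨isEmbedding_daggerCtxMap c ih.1, isEmbedding_daggerCtxMap c ih.2⟩

theorem isEmbedding_cell {n : ℕ} (A : SessionType n) (X : Ctx.{u} n) :
    IsEmbedding ((interp c A).cell.app X) :=
  ScottDom.isEmbedding_lift ((isEmbedding_cellNeg_and_cellPos c A).1 X)
    ((isEmbedding_cellNeg_and_cellPos c A).2 X)

/-- The negative 2-cell denoted by a session type. -/
noncomputable def negCell {n : ℕ} (A : SessionType n) : Cell (Ctx.{u} n) ScottDom.{u} :=
  ⟨(interp c A).bi, (interp c A).neg, (interp c A).cellNeg⟩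

/-- The positive 2-cell denoted by a session type. -/
noncomputable def posCell {n : ℕ} (A : SessionType n) : Cell (Ctx.{u} n) ScottDom.{u} :=
  ⟨(interp c A).bi, (interp c A).pos, (interp c A).cellPos⟩

theorem negCell_subst {n m : ℕ} (A : SessionType n) (B : Fin n → SessionType m) :
    negCell c (A.subst B) = (Cell.tuple fun i => negCell c (B i)).comp (negCell c A) :=
  Cell.interp_subst (c := c) (T := negCell c) (fun _ => rfl)
    (fun A => (Cell.daggerCtx_eq c (negCell c A)).symm) A B

theorem posCell_subst {n m : ℕ} (A : SessionType n) (B : Fin n → SessionType m) :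
    posCell c (A.subst B) = (Cell.tuple fun i => posCell c (B i)).comp (posCell c A) :=
  Cell.interp_subst (c := c) (T := posCell c) (fun _ => rfl)
    (fun A => (Cell.daggerCtx_eq c (posCell c A)).symm) A B

/-- The paired 2-cells lie over functors that are only propositionally equal; equality of the
bundled cells supplies these identifications. -/
theorem prodLift_heq {C : Type u₁} [Category.{v₁} C] [OCategory C]
    {F F' N N' P P' : LCFunctor C ScottDom.{u}} {η : F.toFunctor ⟶ N.toFunctor}
    {θ : F.toFunctor ⟶ P.toFunctor} {η' : F'.toFunctor ⟶ N'.toFunctor}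
    {θ' : F'.toFunctor ⟶ P'.toFunctor} (h : (⟨F, N, η⟩ : Cell C ScottDom.{u}) = ⟨F', N', η'⟩)
    (h' : (⟨F, P, θ⟩ : Cell C ScottDom.{u}) = ⟨F', P', θ'⟩) :
    prodLift η θ ≍ prodLift η' θ' := by
  cases h
  cases h'
  rfl

end Polarities

end SessionSem

open SessionSem
theorem mainTheorem8 :
    SupportsCanonicalFixedPoints ScottDom.{u} ∧
    ∀ c : FixChoice ScottDom.{u},
      (∀ (n : ℕ) (A : SessionType n) (X : Ctx.{u} n), IsEmbedding ((interp c A).cell.app X)) ∧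
      ∀ (n m : ℕ) (A : SessionType n) (B : Fin n → SessionType m),
        (interp c (A.subst B)).bi =
          (LCFunctor.tuple fun i => (interp c (B i)).bi).comp (interp c A).bi ∧
        (interp c (A.subst B)).neg =
          (LCFunctor.tuple fun i => (interp c (B i)).neg).comp (interp c A).neg ∧
        (interp c (A.subst B)).pos =
          (LCFunctor.tuple fun i => (interp c (B i)).pos).comp (interp c A).pos ∧
        (interp c (A.subst B)).cell ≍
          prodLift
            (tupleTrans (fun i => (interp c (B i)).cellNeg) ◫ (interp c A).cellNeg)
            (tupleTrans (fun i => (interp c (B i)).cellPos) ◫ (interp c A).cellPos) := by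
  refine ⟨ScottDom.supportsCanonicalFixedPoints, fun c =>
    ⟨fun n A X => isEmbedding_cell c A X, fun n m A B => ?_⟩⟩
  exact ⟨congrArg Cell.src (negCell_subst c A B), congrArg Cell.tgt (negCell_subst c A B),
    congrArg Cell.tgt (posCell_subst c A B),
    prodLift_heq (negCell_subst c A B) (posCell_subst c A B)⟩
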